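/- **Setting.** Let $0\le r<p$ be integers, $\Theta\subseteq\mathbb R^p$, and let $\{f(\cdot;\theta):\theta\in\Theta\}$ be probability densities on $\mathbb R^m$ with respect to a product $\nu_1\otimes\dots\otimes\nu_m$ of $\sigma$-finite measures (e.g. Lebesgue measure); $P_\theta$ is the distribution with density $f(\cdot;\theta)$. For $A\subseteq\{1,\dots,m\}$ let $f_A(\cdot;\theta)$ be the marginal density of $(y_j)_{j\in A}$, obtained by integrating out the other coordinates ($f_\emptyset=1$). For $k=1,\dots,K$ let $A_k\neq\emptyset$ and $B_k$ be disjoint sets of coordinates and $w_k\ge 0$ known weights. The $k$-th component is the conditional density $f_{A_k\mid B_k}=f_{A_k\cup B_k}/f_{B_k}$ (a marginal density when $B_k=\emptyset$), and the composite log-density is $$c\ell(\theta,y)=\sum_{k=1}^K w_k\log f_{A_k\mid B_k}(y;\theta).$$ Put $u(\theta,y)=\partial c\ell(\theta,y)/\partial\theta$ and $H(\theta)=E_\theta[-\tfrac{\partial}{\partial\theta}u^T(\theta,Y)]$ (a $p\times p$ matrix). Let $g:\mathbb R^p\to\mathbb R^r$, let $G(\theta)=\partial g^T(\theta)/\partial\theta$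 (a $p\times r$ matrix) and $$Q(\theta)=-H^{-1}(\theta)G(\theta)\left[G^T(\theta)H^{-1}(\theta)G(\theta)\right]^{-1}.$$ **Assumptions.** Let $\theta$ be the true parameter; $\theta$ is an interior point of $\Theta$, $g(\theta)=0$, $g$ is continuously differentiable near $\theta$ and $\operatorname{rank}G(\theta)=r$. Moreover: 1. (common support) for $P_\theta$-almost every $y$, all densities $f_{A_k\cup B_k}(y;\theta')$ and $f_{B_k}(y;\theta')$, $\theta'\in\Theta$, $1\le k\le K$, are positive; 2. (smoothness) there are $\varepsilon>0$ and a $P_\theta$-integrable $M$ such that, for $P_\theta$-almost every $y$, $c\ell(\cdot,y)$ is twice continuously differentiable on $\{\theta':\|\theta'-\theta\|<\varepsilon\}$ with second derivative bounded there in norm by $M(y)$; 3. $E_\theta\|u(\theta,Y)\|^2<\infty$ and $H(\theta)$ is positive definite; 4. (Wald identifiability condition) for every neighbourhood $U$ of $\theta$ there is an integer $s$ such that, for independent $Y_1,\dots,Y_s\sim P_\theta$, $$E_\theta\Big[\sup_{\theta'\in\Theta\setminus U}\ \sum_{i=1}^s\{c\ell(\theta',Y_i)-c\ell(\theta,Y_i)\}\Big]<0,$$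 in the sense that for $P_\theta^{\otimes s}$-almost every sample the supremum is at most the value of some $P_\theta^{\otimes s}$-integrable function with negative expectation. **Claim.** Let $y_1,y_2,\dots$ be independent with distribution $P_\theta$. Let $\widehat\theta_c=\widehat\theta_{c,n}$ and $\widetilde\theta_{rc}=\widetilde\theta_{rc,n}$ be unrestricted and restricted maximum composite likelihood estimators, that is, with probability tending to one as $n\to\infty$, $\widehat\theta_c$ maximizes $\theta'\mapsto\sum_{i=1}^n c\ell(\theta',y_i)$ over $\Theta$, and $\widetilde\theta_{rc}$ maximizes it over $\{\theta'\in\Theta: g(\theta')=0\}$. Then, as $n\to\infty$, $$\sqrt n(\widetilde\theta_{rc}-\theta)=\left(I_p+Q(\theta)G^T(\theta)\right)\sqrt n(\widehat\theta_c-\theta)+o_P(1),$$ where $o_P(1)$ is a sequence tending to $0$ in $P_\theta$-probability. -/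

import Mathlib

open MeasureTheory ProbabilityTheory Filter Topology

noncomputable section

namespace CompLik

/-- The parameter space `ℝ^p` with its Euclidean norm. -/
abbrev Param (p : ℕ) : Type := EuclideanSpace ℝ (Fin p)

/-- A parametric family of densities `f(· ; θ)`, `θ ∈ Θ ⊆ ℝ^p`, for a random `m`-vector, taken with
respect to a product of sigma-finite measures on the line (Lebesgue measure in the continuous
case). -/
structure Family (m p : ℕ) where
  /-- the coordinate dominating measures -/
  ν : Fin m → Measure ℝ
  sigmaFinite_ν : ∀ j, SigmaFinite (ν j)
  /-- the parameter set -/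
  Θ : Set (Param p)
  /-- the joint densities -/
  f : Param p → (Fin m → ℝ) → ℝ
  measurable_f : ∀ θ ∈ Θ, Measurable (f θ)
  f_nonneg : ∀ θ ∈ Θ, ∀ y, 0 ≤ f θ y
  lintegral_f : ∀ θ ∈ Θ, ∫⁻ y, ENNReal.ofReal (f θ y) ∂(Measure.pi ν) = 1

/-- The events and weights of a composite likelihood: the `k`-th component is the conditional
density of the coordinates in `A k` given those in `B k`; it is the marginal density of the
coordinates in `A k` when `B k = ∅`. -/
structure Scheme (m K : ℕ) where
  A : Fin K → Finset (Fin m)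
  B : Fin K → Finset (Fin m)
  nonempty_A : ∀ k, (A k).Nonempty
  disjoint_AB : ∀ k, Disjoint (A k) (B k)
  /-- the weights -/
  w : Fin K → ℝ
  w_nonneg : ∀ k, 0 ≤ w k

variable {m p K r : ℕ}

/-- The distribution `P_θ` with density `f(· ; θ)`. -/
def Family.law (F : Family m p) (θ : Param p) : Measure (Fin m → ℝ) :=
  (Measure.pi F.ν).withDensity (fun y => ENNReal.ofReal (F.f θ y))

/-- The marginal density of the coordinates in `A`, at `(y_j)_{j ∈ A}`: the coordinates outside `A`
are integrated out. It depends on `y` only through its coordinates in `A`. -/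
def Family.marginal (F : Family m p) (A : Finset (Fin m)) (θ : Param p) (y : Fin m → ℝ) : ℝ :=
  ∫ z : {j : Fin m // j ∉ A} → ℝ,
    F.f θ (fun j => if h : j ∈ A then y j else z ⟨j, h⟩)
    ∂(Measure.pi (fun j : {j : Fin m // j ∉ A} => F.ν j))

/-- The component density `f_{A_k}`: conditional density of the coordinates in `A k` given those in
`B k`. For `B k = ∅` the denominator is the total mass `1` of the joint density. -/
def component (F : Family m p) (S : Scheme m K) (k : Fin K) (θ : Param p) (y : Fin m → ℝ) : ℝ :=
  F.marginal (S.A k ∪ S.B k) θ y / F.marginal (S.B k) θ y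

/-- The composite log-density `cℓ(θ, y) = ∑ₖ wₖ log f_{A_k}(θ, y)`. -/
def cl (F : Family m p) (S : Scheme m K) (θ : Param p) (y : Fin m → ℝ) : ℝ :=
  ∑ k, S.w k * Real.log (component F S k θ y)

/-- The composite score `u(θ, y) = ∂ cℓ(θ, y) / ∂θ`. -/
def score (F : Family m p) (S : Scheme m K) (θ : Param p) (y : Fin m → ℝ) : Param p :=
  gradient (fun θ' => cl F S θ' y) θ

/-- The sensitivity matrix `H(θ) = E_θ[-∂ uᵀ(θ, Y) / ∂θ]`. -/
def sensitivity (F : Family m p) (S : Scheme m K) (θ : Param p) : Matrix (Fin p) (Fin p) ℝ :=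
  Matrix.of fun i j => ∫ y,
    -(fderiv ℝ (fun θ' => score F S θ' y j) θ (EuclideanSpace.single i 1)) ∂(F.law θ)

/-- The `p × r` matrix `G(θ) = ∂ gᵀ(θ) / ∂θ`. -/
def jac (g : Param p → EuclideanSpace ℝ (Fin r)) (θ : Param p) : Matrix (Fin p) (Fin r) ℝ :=
  Matrix.of fun i j => fderiv ℝ g θ (EuclideanSpace.single i 1) j

/-- `Q(θ) = -H⁻¹ G (Gᵀ H⁻¹ G)⁻¹`. -/
def Qmat (F : Family m p) (S : Scheme m K) (g : Param p → EuclideanSpace ℝ (Fin r))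
    (θ : Param p) : Matrix (Fin p) (Fin r) ℝ :=
  -((sensitivity F S θ)⁻¹ * jac g θ *
    ((jac g θ).transpose * (sensitivity F S θ)⁻¹ * jac g θ)⁻¹)

/-- `t` maximizes the composite log-likelihood of the sample `y₀, …, y_{n-1}` over the set `C`. -/
def IsArgmax (F : Family m p) (S : Scheme m K) (C : Set (Param p)) (n : ℕ)
    (y : ℕ → Fin m → ℝ) (t : Param p) : Prop :=
  t ∈ C ∧ ∀ θ ∈ C, ∑ i ∈ Finset.range n, cl F S θ (y i) ≤ ∑ i ∈ Finset.range n, cl F S t (y i)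

/-- `T n` is, with probability tending to one, a maximizer over `C` of the composite
log-likelihood of the first `n` observations. -/
def IsArgmaxEstimator {Ω : Type*} [MeasurableSpace Ω] (μ : Measure Ω) (F : Family m p)
    (S : Scheme m K) (C : Set (Param p)) (Y : ℕ → Ω → Fin m → ℝ) (T : ℕ → Ω → Param p) : Prop :=
  Tendsto (fun n => μ {ω | ¬ IsArgmax F S C n (fun i => Y i ω) (T n ω)}) atTop (𝓝 0)

/-- The regularity conditions on the model at the true parameter `θ₀`. -/
structure Regular (F : Family m p) (S : Scheme m K) (θ₀ : Param p) : Prop where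
  /-- the true parameter is an interior point of the parameter set -/
  interior : θ₀ ∈ interior F.Θ
  /-- common support: all marginal densities occurring in the composite density are positive -/
  pos : ∀ᵐ y ∂(F.law θ₀), ∀ θ ∈ F.Θ, ∀ k,
    0 < F.marginal (S.A k ∪ S.B k) θ y ∧ 0 < F.marginal (S.B k) θ y
  /-- smoothness near `θ₀`, with second derivatives dominated by an integrable function -/
  smooth : ∃ ε > 0, ∃ M : (Fin m → ℝ) → ℝ, Integrable M (F.law θ₀) ∧
    ∀ᵐ y ∂(F.law θ₀), ContDiffOn ℝ 2 (fun θ => cl F S θ y) (Metric.ball θ₀ ε) ∧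
      ∀ θ ∈ Metric.ball θ₀ ε, ‖iteratedFDeriv ℝ 2 (fun θ' => cl F S θ' y) θ‖ ≤ M y
  /-- the score has finite second moments -/
  score_sq : Integrable (fun y => ‖score F S θ₀ y‖ ^ 2) (F.law θ₀)
  /-- the sensitivity matrix is positive definite -/
  posDef : (sensitivity F S θ₀).PosDef
  /-- identifiability of `θ₀` from the composite density, in Wald's form: off any neighbourhood of
  `θ₀`, the supremum of the composite log-likelihood ratio of some number `s` of independent
  observations has negative expectation -/
  wald : ∀ U ∈ 𝓝 θ₀, ∃ s : ℕ, ∃ b : (Fin s → Fin m → ℝ) → ℝ,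
    Integrable b (Measure.pi fun _ => F.law θ₀) ∧
    ∫ z, b z ∂(Measure.pi fun _ => F.law θ₀) < 0 ∧
    ∀ᵐ z ∂(Measure.pi fun _ : Fin s => F.law θ₀), ∀ θ ∈ F.Θ \ U,
      ∑ i, (cl F S θ (z i) - cl F S θ₀ (z i)) ≤ b z

end CompLik

end

/-!
The argument treats both estimators at once, as maximizers over a set `C` (the parameter set, or its
intersection with `{g = 0}`) of a criterion which is locally quadratic.

By a second-order Taylor expansion and the law of large numbers, the mean composite log-likelihood
ratio of `θ₀ + v` and `θ₀` is `B(d, v) - B(v, v) / 2 + o_P(1) ‖v‖²`, uniformly in small `v`. Here `B`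
is the bilinear form of the sensitivity matrix `H` and `d = H⁻¹ u`, with `u` the mean score
(`Regular.locallyQuadratic`). Completing the square, a maximizer of such a criterion over `C` which
tends to `θ₀` is `θ₀ + P d + o(‖d‖)`, where `P` is the `B`-orthogonal projection onto the tangent
space of `C` at `θ₀` (`LocallyQuadratic.argmax_sub_proj_isLittleO`). For the parameter set, `P` is
the identity, because `θ₀` is an interior point. For the constrained set the tangent space is the
kernel of `Gᵀ`, by the implicit function theorem (`exists_tangent_map`), and the projection is
`I + Q Gᵀ` (`transpose_mul_projMat`, `transpose_mul_mul_projMat`). Hence the difference of the two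
sides of the claim is `o_P(√n ‖d‖)`, and `√n d` is stochastically bounded by Chebyshev's inequality.

Wald's condition is used twice. It gives the consistency of both estimators
(`eventually_sum_neg_of_wald`), and it makes `θ₀` a maximizer of the expected composite
log-likelihood, so that the score has mean zero (`Regular.integral_score`); differentiation under
the integral sign of the densities is not needed.

The estimators need not be measurable. Convergence in probability is therefore expressed through
the filter `probFilter` of the events whose complements have outer measure tending to zero. The
calculus of `Tendsto`, `=O` and `=o` along that filter replaces that of `o_P` and `O_P`.
-/

namespace CompLik

open Asymptotics

/-! ### Maximizers of a locally quadratic criterion -/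

section Argmax

variable {E ι : Type*} [NormedAddCommGroup E] [NormedSpace ℝ E] {l : Filter ι}

lemma isLittleO_bilin (B : E →L[ℝ] E →L[ℝ] ℝ) {a z d : ι → E} (ha : a =o[l] d) (hz : z =O[l] d) :
    (fun x => B (a x) (z x)) =o[l] fun x => ‖d x‖ ^ 2 := by
  have h1 : (fun x => B (a x) (z x)) =O[l] fun x => ‖a x‖ * ‖z x‖ := by
    refine IsBigO.of_bound ‖B‖ (Eventually.of_forall fun x => ?_)
    rw [norm_mul, norm_norm, norm_norm, ← mul_assoc]
    exact B.le_opNorm₂ _ _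
  refine h1.trans_isLittleO ?_
  simp only [pow_two]
  exact ha.norm_norm.mul_isBigO hz.norm_norm

/-- A criterion function `Λ x` is, along `l`, locally quadratic with centre `d x` and curvature
`B`. -/
def LocallyQuadratic (l : Filter ι) (B : E →L[ℝ] E →L[ℝ] ℝ) (d : ι → E) (Λ : ι → E → ℝ) : Prop :=
  ∀ η > 0, ∃ ρ > 0, ∀ᶠ x in l, ∀ v : E, ‖v‖ < ρ →
    |Λ x v - (B (d x) v - 1 / 2 * B v v)| ≤ η * ‖v‖ ^ 2

variable {B : E →L[ℝ] E →L[ℝ] ℝ} {d : ι → E} {Λ : ι → E → ℝ}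

lemma LocallyQuadratic.isLittleO (hΛ : LocallyQuadratic l B d Λ) {h : ι → E}
    (hh : Tendsto h l (𝓝 0)) :
    (fun x => Λ x (h x) - (B (d x) (h x) - 1 / 2 * B (h x) (h x))) =o[l] fun x => ‖h x‖ ^ 2 := by
  refine IsLittleO.of_bound fun η hη => ?_
  obtain ⟨ρ, hρ, hx⟩ := hΛ η hη
  filter_upwards [hx, hh (Metric.ball_mem_nhds 0 hρ)] with x h1 h2
  rw [Real.norm_eq_abs, norm_pow, norm_norm]
  exact h1 _ (by simpa using h2)

/-- A point which is at least as good as `0` is of the order of the centre `d`. -/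
lemma LocallyQuadratic.isBigO_of_nonneg (hΛ : LocallyQuadratic l B d Λ) (hB : IsCoercive B)
    {h : ι → E} (hh : Tendsto h l (𝓝 0)) (hpos : ∀ᶠ x in l, Λ x 0 ≤ Λ x (h x)) : h =O[l] d := by
  obtain ⟨c, hc, hcB⟩ := hB
  obtain ⟨ρ, hρ, hx⟩ := hΛ (c / 4) (by positivity)
  refine IsBigO.of_bound (4 * ‖B‖ / c) ?_
  filter_upwards [hx, hh (Metric.ball_mem_nhds 0 hρ), hpos] with x h1 h2 h3
  have h0 := h1 0 (by simpa using hρ)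
  have h4 := h1 (h x) (by simpa using h2)
  simp only [map_zero, sub_zero, mul_zero, norm_zero] at h0
  have h0' : Λ x 0 = 0 := by
    refine abs_nonpos_iff.1 (h0.trans (by simp))
  have h5 := (abs_le.1 h4).2
  have h6 := hcB (h x)
  have h7 : B (d x) (h x) ≤ ‖B‖ * ‖d x‖ * ‖h x‖ :=
    (le_abs_self _).trans (B.le_opNorm₂ _ _)
  rcases eq_or_lt_of_le (norm_nonneg (h x)) with h8 | h8
  · rw [← h8]; positivity
  · have h9 : c / 4 * ‖h x‖ * ‖h x‖ ≤ ‖B‖ * ‖d x‖ * ‖h x‖ := by nlinarith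
    have h10 := le_of_mul_le_mul_right h9 h8
    rw [div_mul_eq_mul_div, le_div_iff₀ hc]
    linarith

/-- A maximizer of a locally quadratic criterion with centre `d` over a set `C` is, up to
`o(‖d‖)`, the `B`-orthogonal projection of `d` onto the tangent space of `C` at `0`, the range of
`P`. That the range of `P` is the tangent space is expressed by the map `φ` into `C`, which is
tangent to `P` at `0`, and by the estimate `v - P v = o(‖v‖)` on `C`. -/
theorem LocallyQuadratic.argmax_sub_proj_isLittleO (hΛ : LocallyQuadratic l B d Λ)
    (hB : IsCoercive B) (hsymm : ∀ u v, B u v = B v u)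
    {P : E →L[ℝ] E} (horth : ∀ u w, B (u - P u) (P w) = 0) {C : Set E} {φ : E → E}
    (hφ : ∀ᶠ v in 𝓝 0, φ v ∈ C) (hφP : (fun v => φ v - P v) =o[𝓝 0] fun v => v)
    (hCP : (fun v => v - P v) =o[𝓝[C] 0] fun v => v) (h0 : (0 : E) ∈ C)
    {h : ι → E} (hd : Tendsto d l (𝓝 0)) (hh : Tendsto h l (𝓝 0))
    (hhC : ∀ᶠ x in l, h x ∈ C) (hmax : ∀ᶠ x in l, ∀ v ∈ C, Λ x v ≤ Λ x (h x)) :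
    (fun x => h x - P (d x)) =o[l] d := by
  have hO : h =O[l] d := hΛ.isBigO_of_nonneg hB hh (hmax.mono fun x hx => hx 0 h0)
  have ha : (fun x => h x - P (h x)) =o[l] d := by
    have h1 : Tendsto h l (𝓝[C] 0) := tendsto_nhdsWithin_iff.2 ⟨hh, hhC⟩
    exact (hCP.comp_tendsto h1).trans_isBigO hO
  have hb : (fun x => φ (d x) - P (d x)) =o[l] d := hφP.comp_tendsto hd
  have hPd : (fun x => P (d x)) =O[l] d := P.isBigO_comp d l
  have hPh : (fun x => P (h x)) =O[l] d := (P.isBigO_comp h l).trans hO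
  have hk : (fun x => φ (d x)) =O[l] d := by
    have := hb.isBigO.add hPd
    simpa using this
  have hk0 : Tendsto (fun x => φ (d x)) l (𝓝 0) := hk.trans_tendsto hd
  have e1 : (fun x => Λ x (h x) - (B (d x) (h x) - 1 / 2 * B (h x) (h x))) =o[l]
      fun x => ‖d x‖ ^ 2 := (hΛ.isLittleO hh).trans_isBigO (hO.norm_norm.pow 2)
  have e2 : (fun x => Λ x (φ (d x)) - (B (d x) (φ (d x)) - 1 / 2 * B (φ (d x)) (φ (d x)))) =o[l]
      fun x => ‖d x‖ ^ 2 := (hΛ.isLittleO hk0).trans_isBigO (hk.norm_norm.pow 2)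
  have e3 := isLittleO_bilin B hb (hPd.sub (isBigO_refl d l))
  have e4 := isLittleO_bilin B hb hb.isBigO
  have e5 := isLittleO_bilin B ha (hPh.sub (isBigO_refl d l))
  have e6 := isLittleO_bilin B ha ha.isBigO
  -- `B(d, v) - B(v, v) / 2 = B(d, d) / 2 - B(v - d, v - d) / 2`, so that the maximizer `h` is about
  -- as close to `d` as `φ d` is; `h` and `φ d` may be replaced by `P h` and `P d`, and the
  -- theorem of Pythagoras leaves `B(P (h - d), P (h - d))` below the sum of all errors.
  have etot := ((((e3.const_mul_left 2).add e4).sub (e5.const_mul_left 2)).sub e6).add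
    ((e1.sub e2).const_mul_left 2)
  obtain ⟨c, hc, hcB⟩ := hB
  have hproj : (fun x => P (h x - d x)) =o[l] d := by
    have hsq : (fun x => ‖P (h x - d x)‖ ^ 2) =o[l] fun x => ‖d x‖ ^ 2 := by
      refine IsBigO.trans_isLittleO ?_ etot
      refine IsBigO.of_bound (1 / c) ?_
      filter_upwards [hmax, hd.eventually hφ] with x hx1 hx2
      have hm := hx1 _ hx2
      have key : c * (‖P (h x - d x)‖ * ‖P (h x - d x)‖) ≤ _ :=
        (mul_assoc c _ _).symm.le.trans (hcB (P (h x - d x)))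
      rw [norm_pow, norm_norm, div_mul_eq_mul_div, le_div_iff₀ hc, one_mul, mul_comm, pow_two]
      refine key.trans (le_trans ?_ (le_abs_self _))
      have o1 := horth (d x) (h x)
      have o2 := horth (d x) (d x)
      have s1 := hsymm (h x) (d x)
      have s2 := hsymm (φ (d x)) (d x)
      have s3 := hsymm (P (h x)) (d x)
      have s4 := hsymm (P (d x)) (d x)
      have s5 := hsymm (P (h x)) (h x)
      have s6 := hsymm (P (d x)) (h x)
      have s7 := hsymm (P (h x)) (P (d x))
      have s8 := hsymm (P (d x)) (φ (d x))
      simp only [map_sub, _root_.sub_apply] at o1 o2 ⊢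
      linarith
    have := IsLittleO.of_pow (n := 2) (f := fun x => ‖P (h x - d x)‖) (g := fun x => ‖d x‖)
      hsq two_ne_zero
    exact this.of_norm_norm
  refine (ha.add hproj).congr_left fun x => ?_
  simp

end Argmax

/-! ### The tangent space of the constraint set -/

/-- Near a regular point, the level set `{g = g a}` is parametrized by the kernel of the derivative,
by a map tangent to the identity. The projection `P` only has to take its values in that kernel. -/
lemma exists_tangent_map {E F : Type*} [NormedAddCommGroup E] [NormedSpace ℝ E] [CompleteSpace E]
    [NormedAddCommGroup F] [NormedSpace ℝ F] [FiniteDimensional ℝ F] {g : E → F} {g' : E →L[ℝ] F}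
    {a : E} (hg : HasStrictFDerivAt g g' a) (hsurj : Function.Surjective g') {P : E →L[ℝ] E}
    (hP : ∀ v, g' (P v) = 0) :
    ∃ φ : E → E, (∀ᶠ v in 𝓝 0, g (a + φ v) = g a) ∧ Tendsto φ (𝓝 0) (𝓝 0) ∧
      (fun v => φ v - P v) =o[𝓝 0] fun v => v := by
  have hr : (g' : E →ₗ[ℝ] F).range = ⊤ := LinearMap.range_eq_top.2 hsurj
  let ψ := hg.implicitFunction g g' hr (g a)
  let P' : E →L[ℝ] (g' : E →ₗ[ℝ] F).ker := P.codRestrict _ (fun v => hP v)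
  have hψ0 : ψ 0 = a :=
    hg.implicitFunction_apply_image hr
  have hP0 : Tendsto P' (𝓝 0) (𝓝 0) := by
    simpa using P'.continuous.tendsto 0
  have hd := (hg.to_implicitFunction hr).hasFDerivAt.isLittleO
  have h1 : (fun v => ψ (P' v) - a - P v) =o[𝓝 0] fun v : E => v := by
    have h2 := hd.comp_tendsto hP0
    have h3 : ((fun x => x - 0) ∘ P') =O[𝓝 0] fun v : E => v := by
      simpa [Function.comp_def] using P'.isBigO_id (𝓝 0)
    refine (h2.trans_isBigO h3).congr_left fun v => ?_
    have : hg.implicitFunction g g' hr (g a) 0 = a := hψ0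
    have hP' : ((P' v : (g' : E →ₗ[ℝ] F).ker) : E) = P v := rfl
    simp [this, ψ, hP']
  refine ⟨fun v => ψ (P' v) - a, ?_, ?_, h1⟩
  · have h2 := hg.map_implicitFunction_eq hr
    have h3 : Tendsto (fun v => (g a, P' v)) (𝓝 0) (𝓝 (g a, 0)) :=
      tendsto_const_nhds.prodMk_nhds hP0
    filter_upwards [h3.eventually h2] with v hv
    simpa [ψ] using hv
  · have h2 : Tendsto ψ (𝓝 0) (𝓝 a) := by
      have := (hg.to_implicitFunction hr).continuousAt.tendsto
      change Tendsto ψ (𝓝 0) (𝓝 (ψ 0)) at this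
      rwa [hψ0] at this
    simpa using (h2.comp hP0).sub_const a

/-! ### The `H`-orthogonal projection onto the kernel of `Gᵀ` -/

section Projection

open Matrix

variable {p r : ℕ} {H : Matrix (Fin p) (Fin p) ℝ} {G : Matrix (Fin p) (Fin r) ℝ}

lemma mulVec_injective_of_rank_eq (hG : G.rank = r) : Function.Injective G.mulVec := by
  have h := LinearMap.finrank_range_add_finrank_ker G.mulVecLin
  rw [show Module.finrank ℝ (LinearMap.range G.mulVecLin) = r from hG] at h
  simp only [Module.finrank_fintype_fun_eq_card, Fintype.card_fin] at h
  have hk : Module.finrank ℝ (LinearMap.ker G.mulVecLin) = 0 := by omega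
  rw [Submodule.finrank_eq_zero] at hk
  exact LinearMap.ker_eq_bot.1 hk

lemma isUnit_transpose_mul_inv_mul (hH : H.PosDef) (hG : G.rank = r) :
    IsUnit (Gᵀ * H⁻¹ * G) := by
  have := hH.inv.conjTranspose_mul_mul_same (mulVec_injective_of_rank_eq hG)
  exact (by simpa using this : (Gᵀ * H⁻¹ * G).PosDef).isUnit

/-- `I + Q Gᵀ`, the projection onto the kernel of `Gᵀ` which is orthogonal with respect to `H`. -/
noncomputable def projMat (H : Matrix (Fin p) (Fin p) ℝ) (G : Matrix (Fin p) (Fin r) ℝ) :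
    Matrix (Fin p) (Fin p) ℝ :=
  1 + -(H⁻¹ * G * (Gᵀ * H⁻¹ * G)⁻¹) * Gᵀ

lemma transpose_mul_projMat (hH : H.PosDef) (hG : G.rank = r) : Gᵀ * projMat H G = 0 := by
  have hu := (Matrix.isUnit_iff_isUnit_det _).1 (isUnit_transpose_mul_inv_mul hH hG)
  have : Gᵀ * H⁻¹ * G * (Gᵀ * H⁻¹ * G)⁻¹ = 1 := Matrix.mul_nonsing_inv _ hu
  rw [projMat, Matrix.mul_add, Matrix.neg_mul, Matrix.mul_neg, Matrix.mul_one, ← Matrix.mul_assoc, ← Matrix.mul_assoc,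
    ← Matrix.mul_assoc, this, Matrix.one_mul, add_neg_cancel]

/-- The matrix form of the `H`-orthogonality of `u - P u` and `P w`. -/
lemma transpose_mul_mul_projMat (hH : H.PosDef) (hG : G.rank = r) :
    (1 - projMat H G)ᵀ * H * projMat H G = 0 := by
  have hsym : Hᵀ = H := by simpa using hH.isHermitian.eq
  have hu := (Matrix.isUnit_iff_isUnit_det _).1 hH.isUnit
  have h1 : (1 - projMat H G)ᵀ = G * (Gᵀ * H⁻¹ * G)⁻¹ᵀ * Gᵀ * H⁻¹ := by
    simp [projMat, Matrix.transpose_mul, Matrix.transpose_nonsing_inv, hsym, Matrix.mul_assoc]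
  rw [h1, Matrix.mul_assoc _ H⁻¹ H, Matrix.nonsing_inv_mul _ hu, Matrix.mul_one,
    Matrix.mul_assoc, transpose_mul_projMat hH hG, Matrix.mul_zero]

end Projection

/-! ### Second-order Taylor expansion with an integrable remainder -/

section Taylor

variable {E : Type*} [NormedAddCommGroup E] [NormedSpace ℝ E]

/-- The remainder of the second-order Taylor expansion of `φ` at `a`. -/
noncomputable def taylorRem (φ : E → ℝ) (a v : E) : ℝ :=
  φ (a + v) - φ a - fderiv ℝ φ a v - 1 / 2 * fderiv ℝ (fderiv ℝ φ) a v v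

lemma norm_fderiv_fderiv_le (φ : E → ℝ) (x : E) :
    ‖fderiv ℝ (fderiv ℝ φ) x‖ ≤ ‖iteratedFDeriv ℝ 2 φ x‖ := by
  refine ContinuousLinearMap.opNorm_le_bound₂ _ (norm_nonneg _) fun u v => ?_
  have h := (iteratedFDeriv ℝ 2 φ x).le_opNorm ![u, v]
  rw [iteratedFDeriv_two_apply] at h
  simpa [Fin.prod_univ_two, mul_assoc] using h

variable {φ : E → ℝ} {a : E} {ε : ℝ}

lemma differentiableAt_fderiv_of_contDiffOn (hφ : ContDiffOn ℝ 2 φ (Metric.ball a ε)) {x : E}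
    (hx : x ∈ Metric.ball a ε) : DifferentiableAt ℝ (fderiv ℝ φ) x :=
  ((hφ.contDiffAt (Metric.isOpen_ball.mem_nhds hx)).fderiv_right
    (m := 1) (by norm_num)).differentiableAt (by norm_num)

lemma continuousAt_fderiv_fderiv_of_contDiffOn (hφ : ContDiffOn ℝ 2 φ (Metric.ball a ε)) {x : E}
    (hx : x ∈ Metric.ball a ε) : ContinuousAt (fderiv ℝ (fderiv ℝ φ)) x :=
  (((hφ.contDiffAt (Metric.isOpen_ball.mem_nhds hx)).fderiv_right
    (m := 1) (by norm_num)).fderiv_right (m := 0) (by norm_num)).continuousAt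

/-- The remainder is controlled by the oscillation of the second derivative: the mean value
inequality is applied first to the derivative and then to the function itself. -/
lemma abs_taylorRem_le (hφ : ContDiffOn ℝ 2 φ (Metric.ball a ε)) {ρ c : ℝ} (hρ : ρ ≤ ε)
    (hc : ∀ x ∈ Metric.ball a ρ, ‖fderiv ℝ (fderiv ℝ φ) x - fderiv ℝ (fderiv ℝ φ) a‖ ≤ c)
    {v : E} (hv : ‖v‖ < ρ) : |taylorRem φ a v| ≤ c * ‖v‖ ^ 2 := by
  set D := fderiv ℝ (fderiv ℝ φ) with hD
  have ha : a ∈ Metric.ball a ρ := Metric.mem_ball_self ((norm_nonneg _).trans_lt hv)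
  have hsub : Metric.ball a ρ ⊆ Metric.ball a ε := Metric.ball_subset_ball hρ
  have hc0 : 0 ≤ c := (norm_nonneg (D a - D a)).trans (hc a ha)
  have h1 : ∀ x ∈ Metric.ball a ρ,
      ‖fderiv ℝ φ x - fderiv ℝ φ a - D a (x - a)‖ ≤ c * ‖x - a‖ := fun x hx =>
    (convex_ball a ρ).norm_image_sub_le_of_norm_hasFDerivWithin_le'
      (fun y hy => (differentiableAt_fderiv_of_contDiffOn hφ
        (hsub hy)).hasFDerivAt.hasFDerivWithinAt) hc ha hx
  have hsymm : ∀ u w, D a u w = D a w u := fun u w =>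
    ((hφ.contDiffAt (Metric.isOpen_ball.mem_nhds (hsub ha))).isSymmSndFDerivAt
      (by simp)).eq u w
  have hder : ∀ x ∈ Metric.ball a ρ,
      HasFDerivAt (fun x => φ x - 1 / 2 * D a (x - a) (x - a))
        (fderiv ℝ φ x - D a (x - a)) x := fun x hx => by
    have e1 : HasFDerivAt φ (fderiv ℝ φ x) x :=
      ((hφ.contDiffAt (Metric.isOpen_ball.mem_nhds (hsub hx))).differentiableAt
        (by norm_num)).hasFDerivAt
    have e2 : HasFDerivAt (fun x => x - a) (ContinuousLinearMap.id ℝ E) x :=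
      (hasFDerivAt_id x).sub_const a
    have e3 := (((D a).hasFDerivAt.comp x e2).clm_apply e2).const_mul (1 / 2 : ℝ)
    refine (e1.sub e3).congr_fderiv ?_
    ext w
    have := hsymm w (x - a)
    simp only [map_sub, _root_.sub_apply] at this
    simp
    linarith
  have hball : Metric.closedBall a ‖v‖ ⊆ Metric.ball a ρ := Metric.closedBall_subset_ball hv
  have h2 := (convex_closedBall a ‖v‖).norm_image_sub_le_of_norm_hasFDerivWithin_le'
    (x := a) (y := a + v) (C := c * ‖v‖) (φ := fderiv ℝ φ a)
    (fun x hx => (hder x (hball hx)).hasFDerivWithinAt)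
    (fun x hx => by
      have := h1 x (hball hx)
      rw [sub_right_comm] at this
      refine this.trans (mul_le_mul_of_nonneg_left ?_ hc0)
      simpa [dist_eq_norm] using hx)
    (Metric.mem_closedBall_self (norm_nonneg _)) (by simp)
  rw [taylorRem, ← Real.norm_eq_abs]
  convert h2 using 1
  · congr 1
    simp
    ring
  · simp; ring

end Taylor

section Measurability

variable {E α : Type*} [NormedAddCommGroup E] [NormedSpace ℝ E] [MeasurableSpace α]
  {μ : Measure α} {f : E → α → ℝ} {a : E}

/-- A directional derivative is an almost everywhere limit of difference quotients. -/
lemma aemeasurable_fderiv_apply (hf : ∀ᶠ θ in 𝓝 a, AEMeasurable (f θ) μ)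
    (hd : ∀ᵐ y ∂μ, DifferentiableAt ℝ (fun θ => f θ y) a) (e : E) :
    AEMeasurable (fun y => fderiv ℝ (fun θ => f θ y) a e) μ := by
  have ht : Tendsto (fun n : ℕ => (1 : ℝ) / ((n : ℝ) + 1)) atTop (𝓝[≠] 0) :=
    tendsto_nhdsWithin_iff.2 ⟨tendsto_one_div_add_atTop_nhds_zero_nat,
      Eventually.of_forall fun n => by
        simp only [Set.mem_compl_iff, Set.mem_singleton_iff]; positivity⟩
  have h1 : Tendsto (fun n : ℕ => a + ((1 : ℝ) / ((n : ℝ) + 1)) • e) atTop (𝓝 a) := by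
    simpa using ((tendsto_one_div_add_atTop_nhds_zero_nat (𝕜 := ℝ)).smul_const e).const_add a
  obtain ⟨N, hN⟩ := eventually_atTop.1 (h1.eventually hf)
  refine aemeasurable_of_tendsto_metrizable_ae atTop (f := fun (n : ℕ) y =>
    ((1 : ℝ) / (((n + N : ℕ) : ℝ) + 1))⁻¹ •
      (f (a + ((1 : ℝ) / (((n + N : ℕ) : ℝ) + 1)) • e) y - f a y)) (fun n => ?_) ?_
  · exact ((hN _ (Nat.le_add_left N n)).sub hf.self_of_nhds).const_smul
      ((1 : ℝ) / (((n + N : ℕ) : ℝ) + 1))⁻¹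
  · filter_upwards [hd] with y hy
    have := (hy.hasFDerivAt.hasLineDerivAt e).tendsto_slope_zero
    exact (this.comp ht).comp (tendsto_add_atTop_nat N)

variable {ε : ℝ} {M : α → ℝ}

/-- Near `a` the function `f θ y` is, for almost every `y`, twice continuously differentiable in
`θ`, with second derivatives dominated by `M y`. -/
structure SmoothDom (μ : Measure α) (f : E → α → ℝ) (a : E) (ε : ℝ) (M : α → ℝ) : Prop where
  pos : 0 < ε
  aemeasurable : ∀ θ ∈ Metric.ball a ε, AEMeasurable (f θ) μ
  integrable : Integrable M μ
  contDiffOn : ∀ᵐ y ∂μ, ContDiffOn ℝ 2 (fun θ => f θ y) (Metric.ball a ε)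
  bound : ∀ᵐ y ∂μ, ∀ θ ∈ Metric.ball a ε, ‖iteratedFDeriv ℝ 2 (fun θ' => f θ' y) θ‖ ≤ M y

namespace SmoothDom

variable (hf : SmoothDom μ f a ε M)
include hf

lemma aemeasurable_fderiv {θ : E} (hθ : θ ∈ Metric.ball a ε) (e : E) :
    AEMeasurable (fun y => fderiv ℝ (fun θ => f θ y) θ e) μ := by
  refine aemeasurable_fderiv_apply ?_ ?_ e
  · filter_upwards [Metric.isOpen_ball.mem_nhds hθ] with x hx using hf.aemeasurable x hx
  · filter_upwards [hf.contDiffOn] with y hy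
    exact (hy.contDiffAt (Metric.isOpen_ball.mem_nhds hθ)).differentiableAt (by norm_num)

lemma aemeasurable_fderiv_fderiv (u v : E) :
    AEMeasurable (fun y => fderiv ℝ (fderiv ℝ fun θ => f θ y) a u v) μ := by
  have ha : a ∈ Metric.ball a ε := Metric.mem_ball_self hf.pos
  have hdiff : ∀ᵐ y ∂μ, DifferentiableAt ℝ (fderiv ℝ fun θ => f θ y) a := by
    filter_upwards [hf.contDiffOn] with y hy using differentiableAt_fderiv_of_contDiffOn hy ha
  have h := aemeasurable_fderiv_apply (μ := μ) (a := a)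
    (f := fun θ y => fderiv ℝ (fun θ => f θ y) θ v)
    (by filter_upwards [Metric.isOpen_ball.mem_nhds ha] with x hx using
          hf.aemeasurable_fderiv hx v)
    (by filter_upwards [hdiff] with y hy using hy.clm_apply (differentiableAt_const v)) u
  refine h.congr ?_
  filter_upwards [hdiff] with y hy
  rw [fderiv_clm_apply hy (differentiableAt_const v)]
  simp

lemma aemeasurable_taylorRem {v : E} (hv : ‖v‖ < ε) :
    AEMeasurable (fun y => taylorRem (fun θ => f θ y) a v) μ := by
  have ha : a ∈ Metric.ball a ε := Metric.mem_ball_self hf.pos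
  exact (((hf.aemeasurable _ (by simpa using hv)).sub (hf.aemeasurable a ha)).sub
    (hf.aemeasurable_fderiv ha v)).sub ((hf.aemeasurable_fderiv_fderiv v v).const_mul _)

lemma norm_fderiv_fderiv_le : ∀ᵐ y ∂μ, ‖fderiv ℝ (fderiv ℝ fun θ => f θ y) a‖ ≤ M y := by
  filter_upwards [hf.bound] with y hy
  exact (CompLik.norm_fderiv_fderiv_le _ _).trans (hy a (Metric.mem_ball_self hf.pos))

lemma integrable_fderiv_fderiv (u v : E) :
    Integrable (fun y => fderiv ℝ (fderiv ℝ fun θ => f θ y) a u v) μ := by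
  refine ((hf.integrable.mul_const ‖u‖).mul_const ‖v‖).mono'
    (hf.aemeasurable_fderiv_fderiv u v).aestronglyMeasurable ?_
  filter_upwards [hf.norm_fderiv_fderiv_le] with y hy
  refine (ContinuousLinearMap.le_opNorm₂ _ _ _).trans ?_
  gcongr

lemma abs_taylorRem_le : ∀ᵐ y ∂μ, ∀ v, ‖v‖ < ε →
    |taylorRem (fun θ => f θ y) a v| ≤ 2 * M y * ‖v‖ ^ 2 := by
  filter_upwards [hf.contDiffOn, hf.bound] with y h1 h2 v hv
  refine CompLik.abs_taylorRem_le h1 le_rfl (fun x hx => ?_) hv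
  have e1 := (CompLik.norm_fderiv_fderiv_le _ _).trans (h2 x hx)
  have e2 := (CompLik.norm_fderiv_fderiv_le _ _).trans (h2 a (Metric.mem_ball_self hf.pos))
  refine (norm_sub_le (fderiv ℝ (fderiv ℝ fun θ' => f θ' y) x) _).trans ?_
  linarith

lemma integrable_taylorRem {v : E} (hv : ‖v‖ < ε) :
    Integrable (fun y => taylorRem (fun θ => f θ y) a v) μ := by
  refine ((hf.integrable.const_mul 2).mul_const (‖v‖ ^ 2)).mono'
    (hf.aemeasurable_taylorRem hv).aestronglyMeasurable ?_
  filter_upwards [hf.abs_taylorRem_le] with y hy using hy v hv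

variable [TopologicalSpace.SeparableSpace E]

/-- On a small ball the Taylor remainder is `R y * ‖v‖ ^ 2` at most, with an `R` of small mean. The
least such `R` is measurable because the supremum over `v` can be taken over a countable dense
set, and its mean tends to zero with the radius by dominated convergence. -/
theorem exists_taylorRem_le {η : ℝ} (hη : 0 < η) :
    ∃ ρ > 0, ∃ R : α → ℝ, Integrable R μ ∧ ∫ y, R y ∂μ ≤ η ∧
      ∀ᵐ y ∂μ, ∀ v, ‖v‖ < ρ → |taylorRem (fun θ => f θ y) a v| ≤ R y * ‖v‖ ^ 2 := by
  classical
  have hε := hf.pos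
  let e : ℕ → E := TopologicalSpace.denseSeq E
  let ρ : ℕ → ℝ := fun k => ε * (1 / ((k : ℝ) + 1))
  have hρpos : ∀ k, 0 < ρ k := fun k => by positivity
  have hρle : ∀ k, ρ k ≤ ε := fun k => by
    refine mul_le_of_le_one_right hε.le ?_
    rw [div_le_one (by positivity)]
    linarith [Nat.cast_nonneg (α := ℝ) k]
  have hρ0 : Tendsto ρ atTop (𝓝 0) := by
    simpa [ρ] using (tendsto_one_div_add_atTop_nhds_zero_nat (𝕜 := ℝ)).const_mul ε
  let q : ℕ → ℕ → α → ENNReal := fun k i y =>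
    if ‖e i‖ < ρ k then
      ENNReal.ofReal (|taylorRem (fun θ => f θ y) a (e i)| / ‖e i‖ ^ 2) else 0
  let R : ℕ → α → ENNReal := fun k y => ⨆ i, q k i y
  have hRm : ∀ k, AEMeasurable (R k) μ := fun k => by
    refine AEMeasurable.iSup fun i => ?_
    by_cases h : ‖e i‖ < ρ k
    · simp only [q, if_pos h]
      exact ((continuous_abs.measurable.comp_aemeasurable
        (hf.aemeasurable_taylorRem (h.trans_le (hρle k)))).div_const _).ennreal_ofReal
    · simp only [q, if_neg h]
      exact aemeasurable_const
  have hRle : ∀ {k y c}, (∀ v, ‖v‖ < ρ k →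
      |taylorRem (fun θ => f θ y) a v| ≤ c * ‖v‖ ^ 2) → R k y ≤ ENNReal.ofReal c := by
    intro k y c h
    refine iSup_le fun i => ?_
    by_cases hi : ‖e i‖ < ρ k
    · simp only [q, if_pos hi]
      rcases eq_or_lt_of_le (norm_nonneg (e i)) with h0 | h0
      · simp [← h0]
      · refine ENNReal.ofReal_le_ofReal ?_
        rw [div_le_iff₀ (by positivity)]
        exact h _ hi
    · simp [q, if_neg hi]
  have hRM : ∀ k, R k ≤ᵐ[μ] fun y => ENNReal.ofReal (2 * M y) := fun k => by
    filter_upwards [hf.abs_taylorRem_le] with y hy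
    exact hRle fun v hv => hy v (hv.trans_le (hρle k))
  have hMfin : ∫⁻ y, ENNReal.ofReal (2 * M y) ∂μ ≠ ⊤ :=
    (hf.integrable.const_mul 2).lintegral_lt_top.ne
  have hR0 : ∀ᵐ y ∂μ, Tendsto (fun k => R k y) atTop (𝓝 0) := by
    filter_upwards [hf.contDiffOn] with y hy
    rw [ENNReal.tendsto_atTop_zero]
    intro c hc
    by_cases hctop : c = ⊤
    · exact ⟨0, fun n _ => hctop ▸ le_top⟩
    have hc' : 0 < c.toReal := ENNReal.toReal_pos hc.ne' hctop
    have hcont := continuousAt_fderiv_fderiv_of_contDiffOn hy (Metric.mem_ball_self hε)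
    have hlim : Tendsto (fun x => ‖fderiv ℝ (fderiv ℝ fun θ => f θ y) x -
        fderiv ℝ (fderiv ℝ fun θ => f θ y) a‖) (𝓝 a) (𝓝 0) := by
      have h1 : ContinuousAt (fun x => fderiv ℝ (fderiv ℝ fun θ => f θ y) x -
          fderiv ℝ (fderiv ℝ fun θ => f θ y) a) a := hcont.sub continuousAt_const
      have h2 := (continuous_norm (E := E →L[ℝ] E →L[ℝ] ℝ)).continuousAt.comp h1
      have h3 : ‖fderiv ℝ (fderiv ℝ fun θ => f θ y) a -
          fderiv ℝ (fderiv ℝ fun θ => f θ y) a‖ = 0 := by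
        rw [sub_self]; exact norm_zero (E := E →L[ℝ] E →L[ℝ] ℝ)
      exact h3 ▸ h2.tendsto
    obtain ⟨δ, hδ, hδc⟩ := Metric.eventually_nhds_iff_ball.1 (hlim.eventually_lt_const hc')
    obtain ⟨N, hN⟩ := eventually_atTop.1 (hρ0.eventually (gt_mem_nhds hδ))
    refine ⟨N, fun k hk => ?_⟩
    rw [← ENNReal.ofReal_toReal hctop]
    refine hRle fun v hv => CompLik.abs_taylorRem_le hy (hρle k) (fun x hx => ?_) hv
    exact (hδc x (Metric.mem_ball.2 ((Metric.mem_ball.1 hx).trans (hN k hk)))).le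
  have hint := tendsto_lintegral_of_dominated_convergence' _ hRm hRM hMfin hR0
  rw [lintegral_zero] at hint
  obtain ⟨k, hk⟩ := (hint.eventually (gt_mem_nhds (ENNReal.ofReal_pos.2 hη))).exists
  have hfin : ∀ᵐ y ∂μ, R k y ≠ ⊤ := by
    filter_upwards [hRM k] with y hy using (hy.trans_lt ENNReal.ofReal_lt_top).ne
  refine ⟨ρ k, hρpos k, fun y => (R k y).toReal,
    integrable_toReal_of_lintegral_ne_top (hRm k) (hk.trans ENNReal.ofReal_lt_top).ne, ?_, ?_⟩
  · rw [integral_toReal (hRm k) (hfin.mono fun y hy => hy.lt_top)]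
    exact ENNReal.toReal_le_of_le_ofReal hη.le hk.le
  -- The bound holds on the dense sequence by definition, and elsewhere by continuity.
  · filter_upwards [hfin, hf.contDiffOn] with y hy hC v hv
    have hcont : ContinuousOn (fun v => |taylorRem (fun θ => f θ y) a v|)
        (Metric.ball 0 (ρ k)) := by
      have h1 : ContinuousOn (fun v => f (a + v) y) (Metric.ball 0 (ρ k)) := by
        refine hC.continuousOn.comp (by fun_prop) fun v hv => ?_
        simpa using (mem_ball_zero_iff.1 hv).trans_le (hρle k)
      have h2 : Continuous fun v => fderiv ℝ (fun θ => f θ y) a v := by fun_prop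
      have h3 : Continuous fun v => fderiv ℝ (fderiv ℝ fun θ => f θ y) a v v := by fun_prop
      exact (((h1.sub continuousOn_const).sub h2.continuousOn).sub
        (h3.continuousOn.const_mul _)).abs
    have hcl : v ∈ closure (Metric.ball 0 (ρ k) ∩ Set.range e) :=
      (TopologicalSpace.denseRange_denseSeq E).open_subset_closure_inter
        Metric.isOpen_ball (by simpa using hv)
    have hvb : v ∈ Metric.ball (0 : E) (ρ k) := by simpa using hv
    refine ContinuousWithinAt.closure_le (f := fun v => |taylorRem (fun θ => f θ y) a v|)
      (g := fun v => (R k y).toReal * ‖v‖ ^ 2) hcl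
      ((hcont v hvb).mono Set.inter_subset_left) (by fun_prop) ?_
    rintro _ ⟨hw, i, rfl⟩
    have hi : ‖e i‖ < ρ k := by simpa using hw
    rcases eq_or_lt_of_le (norm_nonneg (e i)) with h0 | h0
    · have : e i = 0 := norm_eq_zero.1 h0.symm
      simp [this, taylorRem]
    · rw [← div_le_iff₀ (by positivity)]
      have h1 : q k i y ≤ R k y := le_iSup (fun i => q k i y) i
      simp only [q, if_pos hi] at h1
      exact (ENNReal.ofReal_le_iff_le_toReal hy).1 h1

end SmoothDom

end Measurability

/-! ### Convergence in probability as convergence along a filter -/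

section ProbFilter

variable {Ω : Type*} [MeasurableSpace Ω] {μ : Measure Ω}

/-- The filter on pairs `(n, ω)` of the events whose probability tends to one as `n → ∞`. Events
need not be measurable: their complements are required to have small outer measure. Convergence in
probability of `X n` is convergence of `(n, ω) ↦ X n ω` along this filter. -/
def probFilter (μ : Measure Ω) : Filter (ℕ × Ω) where
  sets := {A | Tendsto (fun n => μ {ω | (n, ω) ∉ A}) atTop (𝓝 0)}
  univ_sets := by simp
  sets_of_superset {A B} hA hAB := by
    refine tendsto_of_tendsto_of_tendsto_of_le_of_le tendsto_const_nhds hA (fun _ => zero_le)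
      fun n => measure_mono fun ω hω h => hω (hAB h)
  inter_sets {A B} hA hB := by
    have h := Tendsto.add hA hB
    rw [add_zero] at h
    refine tendsto_of_tendsto_of_tendsto_of_le_of_le tendsto_const_nhds h (fun _ => zero_le)
      fun n => (measure_mono fun ω hω => ?_).trans (measure_union_le _ _)
    simp only [Set.mem_ofPred_eq, Set.mem_inter_iff, not_and_or] at hω
    exact hω

lemma eventually_probFilter {p : ℕ × Ω → Prop} :
    (∀ᶠ x in probFilter μ, p x) ↔ Tendsto (fun n => μ {ω | ¬ p (n, ω)}) atTop (𝓝 0) :=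
  Iff.rfl

lemma tendsto_fst_probFilter : Tendsto Prod.fst (probFilter μ) atTop := by
  refine tendsto_atTop.2 fun N => eventually_probFilter.2 ?_
  refine tendsto_const_nhds.congr' ?_
  filter_upwards [eventually_ge_atTop N] with n hn
  simp [hn]

lemma eventually_probFilter_of_ae {p : Ω → Prop} (h : ∀ᵐ ω ∂μ, p ω) :
    ∀ᶠ x in probFilter μ, p x.2 := by
  rw [eventually_probFilter]
  have : μ {ω | ¬ p ω} = 0 := h
  simp [this]

lemma tendstoInMeasure_iff_tendsto_probFilter {E : Type*} [PseudoEMetricSpace E]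
    {X : ℕ → Ω → E} {c : E} :
    TendstoInMeasure μ X atTop (fun _ => c) ↔
      Tendsto (fun x : ℕ × Ω => X x.1 x.2) (probFilter μ) (𝓝 c) := by
  rw [EMetric.tendsto_nhds]
  simp only [eventually_probFilter, not_lt]
  exact Iff.rfl

/-- Stochastic boundedness, `X n = O_P(1)`. -/
def BoundedInProb {E : Type*} [Norm E] (μ : Measure Ω) (X : ℕ → Ω → E) : Prop :=
  ∀ δ : ENNReal, 0 < δ → ∃ K : ℝ, ∀ n, μ {ω | K ≤ ‖X n ω‖} ≤ δ

lemma BoundedInProb.of_norm_le {E F : Type*} [SeminormedAddCommGroup E] [SeminormedAddCommGroup F]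
    {X : ℕ → Ω → E} {Z : ℕ → Ω → F} (hX : BoundedInProb μ X) {C : ℝ}
    (h : ∀ n ω, ‖Z n ω‖ ≤ C * ‖X n ω‖) : BoundedInProb μ Z := by
  intro δ hδ
  obtain ⟨K, hK⟩ := hX δ hδ
  refine ⟨(|C| + 1) * max K 1, fun n => (measure_mono fun ω hω => ?_).trans (hK n)⟩
  have h1 : (|C| + 1) * max K 1 ≤ (|C| + 1) * ‖X n ω‖ :=
    (le_trans hω (h n ω)).trans (by
      gcongr
      linarith [le_abs_self C])
  exact (le_max_left K 1).trans (le_of_mul_le_mul_left h1 (by positivity))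

lemma BoundedInProb.add {E : Type*} [SeminormedAddCommGroup E] {X Z : ℕ → Ω → E}
    (hX : BoundedInProb μ X) (hZ : BoundedInProb μ Z) :
    BoundedInProb μ fun n ω => X n ω + Z n ω := by
  intro δ hδ
  obtain ⟨K, hK⟩ := hX (δ / 2) (ENNReal.half_pos hδ.ne')
  obtain ⟨K', hK'⟩ := hZ (δ / 2) (ENNReal.half_pos hδ.ne')
  refine ⟨K + K', fun n => ?_⟩
  calc μ {ω | K + K' ≤ ‖X n ω + Z n ω‖}
      ≤ μ ({ω | K ≤ ‖X n ω‖} ∪ {ω | K' ≤ ‖Z n ω‖}) := measure_mono fun ω hω => by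
        by_contra! h
        simp only [Set.mem_union, Set.mem_ofPred_eq, not_or, not_le] at h hω
        linarith [norm_add_le (X n ω) (Z n ω)]
    _ ≤ δ / 2 + δ / 2 := (measure_union_le _ _).trans (add_le_add (hK n) (hK' n))
    _ = δ := ENNReal.add_halves δ

lemma BoundedInProb.sum {E ι : Type*} [SeminormedAddCommGroup E] (s : Finset ι)
    {X : ι → ℕ → Ω → E} (hX : ∀ i ∈ s, BoundedInProb μ (X i)) :
    BoundedInProb μ fun n ω => ∑ i ∈ s, X i n ω := by
  classical
  induction s using Finset.induction_on with
  | empty => exact fun δ hδ => ⟨1, fun n => by simp [not_le.2 (zero_lt_one (α := ℝ))]⟩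
  | insert i s hi ih =>
    simp only [Finset.sum_insert hi]
    exact (hX i (by simp)).add (ih fun j hj => hX j (by simp [hj]))

/-- `o_P(O_P(1)) = o_P(1)`. -/
lemma BoundedInProb.tendsto_zero_of_isLittleO {E F : Type*} [SeminormedAddCommGroup E]
    [SeminormedAddCommGroup F] {X : ℕ → Ω → E} {Z : ℕ × Ω → F} (hX : BoundedInProb μ X)
    (hZ : Z =o[probFilter μ] fun x => X x.1 x.2) : Tendsto Z (probFilter μ) (𝓝 0) := by
  rw [Metric.tendsto_nhds]
  intro ε hε
  rw [eventually_probFilter, ENNReal.tendsto_nhds_zero]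
  intro δ hδ
  obtain ⟨K, hK⟩ := hX (δ / 2) (ENNReal.half_pos hδ.ne')
  have h1 := (hZ.bound (c := ε / (max K 1)) (by positivity))
  rw [eventually_probFilter, ENNReal.tendsto_nhds_zero] at h1
  filter_upwards [h1 (δ / 2) (ENNReal.half_pos hδ.ne')] with n hn
  calc μ {ω | ¬ dist (Z (n, ω)) 0 < ε}
      ≤ μ ({ω | ¬ ‖Z (n, ω)‖ ≤ ε / (max K 1) * ‖X n ω‖} ∪ {ω | K ≤ ‖X n ω‖}) :=
        measure_mono fun ω hω => by
          by_contra! h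
          simp only [Set.mem_union, Set.mem_ofPred_eq, not_or, not_le, not_lt,
            dist_zero_right] at h hω
          have h2 : ε / (max K 1) * ‖X n ω‖ < ε / (max K 1) * (max K 1) :=
            mul_lt_mul_of_pos_left (h.2.trans_le (le_max_left _ _)) (by positivity)
          rw [div_mul_cancel₀ _ (by positivity)] at h2
          linarith
    _ ≤ δ / 2 + δ / 2 := (measure_union_le _ _).trans (add_le_add hn (hK n))
    _ = δ := ENNReal.add_halves δ

end ProbFilter

/-! ### Laws of large numbers and stochastic bounds for samples -/

section Sample

variable {Ω β : Type*} [MeasurableSpace Ω] [MeasurableSpace β] {μ : Measure Ω} {Q : Measure β}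

lemma _root_.ProbabilityTheory.HasLaw.integrable_comp {Z : Ω → β} (hZ : HasLaw Z Q μ) {φ : β → ℝ}
    (hφ : Integrable φ Q) : Integrable (fun ω => φ (Z ω)) μ :=
  (show Integrable φ (μ.map Z) by rwa [hZ.map_eq]).comp_aemeasurable hZ.aemeasurable

lemma _root_.ProbabilityTheory.HasLaw.ae_comp {Z : Ω → β} (hZ : HasLaw Z Q μ) {s : β → Prop}
    (hs : ∀ᵐ z ∂Q, s z) : ∀ᵐ ω ∂μ, s (Z ω) :=
  ae_of_ae_map hZ.aemeasurable (by rwa [hZ.map_eq])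

lemma indepFun_comp_of_hasLaw {Z Z' : Ω → β} (hZ : HasLaw Z Q μ) (hZ' : HasLaw Z' Q μ)
    (h : IndepFun Z Z' μ) {φ : β → ℝ} (hφ : AEMeasurable φ Q) :
    IndepFun (fun ω => φ (Z ω)) (fun ω => φ (Z' ω)) μ :=
  h.comp₀ hZ.aemeasurable hZ'.aemeasurable (by rwa [hZ.map_eq]) (by rwa [hZ'.map_eq])

lemma identDistrib_comp_of_hasLaw {Z Z' : Ω → β} (hZ : HasLaw Z Q μ) (hZ' : HasLaw Z' Q μ)
    {φ : β → ℝ} (hφ : AEMeasurable φ Q) :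
    IdentDistrib (fun ω => φ (Z ω)) (fun ω => φ (Z' ω)) μ μ :=
  (hZ.identDistrib hZ').comp_of_aemeasurable (by rwa [hZ.map_eq])

variable {Z : ℕ → Ω → β} (hZ : ∀ i, HasLaw (Z i) Q μ)
  (hind : Pairwise fun i j => IndepFun (Z i) (Z j) μ)
include hZ hind

lemma ae_tendsto_mean {φ : β → ℝ} (hφ : Integrable φ Q) :
    ∀ᵐ ω ∂μ, Tendsto (fun n : ℕ => (∑ i ∈ Finset.range n, φ (Z i ω)) / n) atTop
      (𝓝 (∫ z, φ z ∂Q)) := by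
  have h := strong_law_ae_real (fun i ω => φ (Z i ω)) ((hZ 0).integrable_comp hφ)
    (fun i j hij => indepFun_comp_of_hasLaw (hZ i) (hZ j) (hind hij) hφ.aemeasurable)
    (fun i => identDistrib_comp_of_hasLaw (hZ i) (hZ 0) hφ.aemeasurable)
  rwa [show ∫ ω, φ (Z 0 ω) ∂μ = ∫ z, φ z ∂Q from
    (hZ 0).integral_comp hφ.aestronglyMeasurable] at h

lemma tendsto_mean_probFilter [IsFiniteMeasure μ] {φ : β → ℝ} (hφ : Integrable φ Q) {q : ℕ → ℕ}
    (hq : Tendsto q atTop atTop) :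
    Tendsto (fun x : ℕ × Ω => (∑ i ∈ Finset.range (q x.1), φ (Z i x.2)) / q x.1) (probFilter μ)
      (𝓝 (∫ z, φ z ∂Q)) := by
  refine (tendstoInMeasure_iff_tendsto_probFilter
    (X := fun n ω => (∑ i ∈ Finset.range (q n), φ (Z i ω)) / q n)).1
    (tendstoInMeasure_of_tendsto_ae (fun n => ?_) ?_)
  · exact ((integrable_finsetSum _ fun i _ =>
      (hZ i).integrable_comp hφ).div_const _).aestronglyMeasurable
  · filter_upwards [ae_tendsto_mean hZ hind hφ] with ω hω using hω.comp hq

/-- By Chebyshev's inequality, normalized sums of centred square-integrable variables are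
stochastically bounded. -/
lemma boundedInProb_sum_div_sqrt [IsProbabilityMeasure μ] [IsFiniteMeasure Q] {φ : β → ℝ}
    (hφ : MemLp φ 2 Q) (h0 : ∫ z, φ z ∂Q = 0) :
    BoundedInProb μ fun n ω => (∑ i ∈ Finset.range n, φ (Z i ω)) / √(n : ℝ) := by
  have hmem : ∀ i, MemLp (fun ω => φ (Z i ω)) 2 μ := fun i =>
    (show MemLp φ 2 (μ.map (Z i)) by rwa [(hZ i).map_eq]).comp_of_map (hZ i).aemeasurable
  have hvar : ∀ i, Var[fun ω => φ (Z i ω); μ] = Var[fun ω => φ (Z 0 ω); μ] := fun i =>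
    (identDistrib_comp_of_hasLaw (hZ i) (hZ 0) hφ.aestronglyMeasurable.aemeasurable).variance_eq
  set σ := Var[fun ω => φ (Z 0 ω); μ] with hσ
  have hσ0 : 0 ≤ σ := variance_nonneg _ _
  intro δ hδ
  have hlim : Tendsto (fun K : ℝ => ENNReal.ofReal (σ / K ^ 2)) atTop (𝓝 0) := by
    have : Tendsto (fun K : ℝ => σ / K ^ 2) atTop (𝓝 0) :=
      tendsto_const_nhds.div_atTop (tendsto_pow_atTop two_ne_zero)
    simpa using ENNReal.tendsto_ofReal this
  obtain ⟨K, hK, hK0⟩ := ((ENNReal.tendsto_nhds_zero.1 hlim δ hδ).and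
    (eventually_gt_atTop 0)).exists
  refine ⟨K, fun n => ?_⟩
  rcases Nat.eq_zero_or_pos n with rfl | hn
  · simp [hK0.not_ge]
  have hn' : (0 : ℝ) < n := by exact_mod_cast hn
  have hsum : MemLp (∑ i ∈ Finset.range n, fun ω => φ (Z i ω)) 2 μ :=
    memLp_finsetSum' _ fun i _ => hmem i
  have hv : Var[∑ i ∈ Finset.range n, fun ω => φ (Z i ω); μ] = n * σ := by
    rw [IndepFun.variance_sum (fun i _ => hmem i) fun i _ j _ hij =>
      indepFun_comp_of_hasLaw (hZ i) (hZ j) (hind hij) hφ.aestronglyMeasurable.aemeasurable]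
    simp [hvar]
  have hm : ∫ ω, (∑ i ∈ Finset.range n, fun ω => φ (Z i ω)) ω ∂μ = 0 := by
    simp only [Finset.sum_apply]
    rw [integral_finsetSum _ fun i _ => (hmem i).integrable (by norm_num)]
    refine Finset.sum_eq_zero fun i _ => ?_
    rw [← h0]
    exact (hZ i).integral_comp hφ.aestronglyMeasurable
  have h := meas_ge_le_variance_div_sq hsum (c := K * √(n : ℝ)) (by positivity)
  rw [hm, hv, mul_pow, Real.sq_sqrt hn'.le, mul_comm (n : ℝ), mul_div_mul_right _ _ hn'.ne'] at h
  refine le_trans (measure_mono fun ω hω => ?_) (h.trans hK)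
  have : K ≤ |(∑ i ∈ Finset.range n, φ (Z i ω)) / √(n : ℝ)| := hω
  rw [abs_div, abs_of_nonneg (Real.sqrt_nonneg _), le_div_iff₀ (by positivity)] at this
  simpa using this

end Sample

/-- A fixed integrable function of variables with a fixed law is negligible with respect to any
sequence tending to infinity. -/
lemma tendsto_div_probFilter {Ω β : Type*} [MeasurableSpace Ω] [MeasurableSpace β] {μ : Measure Ω}
    {Q : Measure β} {W : ℕ → Ω → β} (hW : ∀ n, HasLaw (W n) Q μ) {φ : β → ℝ} (hφ : Integrable φ Q)
    {q : ℕ → ℕ} (hq : Tendsto q atTop atTop) :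
    Tendsto (fun x : ℕ × Ω => φ (W x.1 x.2) / q x.1) (probFilter μ) (𝓝 0) := by
  rw [Metric.tendsto_nhds]
  intro ε hε
  rw [eventually_probFilter]
  have hfin : ∫⁻ z, ‖φ z‖ₑ ∂Q ≠ ⊤ := hφ.2.ne
  have hlim : Tendsto (fun n => (∫⁻ z, ‖φ z‖ₑ ∂Q) / ENNReal.ofReal (ε * q n)) atTop (𝓝 0) := by
    have h1 : Tendsto (fun n => ENNReal.ofReal (ε * q n)) atTop (𝓝 ⊤) :=
      ENNReal.tendsto_ofReal_atTop.comp
        ((tendsto_natCast_atTop_atTop.comp hq).const_mul_atTop hε)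
    simpa using ENNReal.Tendsto.const_div h1 (Or.inr hfin)
  refine tendsto_of_tendsto_of_tendsto_of_le_of_le' tendsto_const_nhds hlim
    (Eventually.of_forall fun _ => zero_le) ?_
  filter_upwards [hq.eventually_gt_atTop 0] with n hn
  have hn' : (0 : ℝ) < q n := by exact_mod_cast hn
  have h2 := meas_ge_le_lintegral_div
    (((hW n).integrable_comp hφ).aestronglyMeasurable.enorm)
    (ε := ENNReal.ofReal (ε * q n)) (by simp; positivity) ENNReal.ofReal_ne_top
  rw [show ∫⁻ ω, ‖φ (W n ω)‖ₑ ∂μ = ∫⁻ z, ‖φ z‖ₑ ∂Q from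
    (hW n).lintegral_comp hφ.aestronglyMeasurable.enorm] at h2
  refine (measure_mono fun ω hω => ?_).trans h2
  simp only [Set.mem_ofPred_eq, not_lt, dist_zero_right, norm_div, RCLike.norm_natCast] at hω ⊢
  rw [le_div_iff₀ hn'] at hω
  rw [← ofReal_norm]
  exact ENNReal.ofReal_le_ofReal hω

/-! ### Wald's condition and consistency -/

/-- Every residue is hit once by a cyclic shift. -/
lemma sum_range_add_mod (f : ℕ → ℝ) (c i : ℕ) :
    ∑ j ∈ Finset.range c, f ((j + i) % c) = ∑ j ∈ Finset.range c, f j := by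
  have h := congrArg (fun s => (s.map f).sum) (Nat.multiset_Ico_map_mod i c)
  simp only [Multiset.map_map] at h
  have h1 : ∑ j ∈ Finset.Ico i (i + c), f (j % c) = ∑ j ∈ Finset.range c, f j := h
  rw [← h1, Finset.sum_Ico_eq_sum_range]
  simp [add_comm]

lemma add_mod_injective {s c : ℕ} (hsc : s ≤ c) (j k : ℕ) :
    Function.Injective fun i : Fin s => k + (j + i) % c := by
  intro a b hab
  have h : (j + a) ≡ (j + b) [MOD c] := Nat.add_left_cancel hab
  have h' := Nat.ModEq.add_left_cancel' j h
  exact Fin.ext (Nat.ModEq.eq_of_lt_of_lt h' (a.2.trans_le hsc) (b.2.trans_le hsc))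

section Wald

variable {Ω α ι : Type*} [MeasurableSpace Ω] [MeasurableSpace α] {μ : Measure Ω}
  [IsProbabilityMeasure μ] {P : Measure α} {Y : ℕ → Ω → α}

/-- Let the sum of `a j` over `s` independent observations be bounded, uniformly in `j ∈ J`, by an
integrable variable with negative mean. Then, with probability tending to one, all sums of `a j`,
`j ∈ J`, over a sample of size `n` are negative.

The sample is cut into blocks of size `s`, to which the law of large numbers applies, and a last
block of size `c` with `s ≤ c < 2 * s`; the sum over the last block is bounded by averaging over its
`c` cyclic windows of length `s`. -/
theorem eventually_sum_neg_of_wald (hY : ∀ i, HasLaw (Y i) P μ) (hind : iIndepFun Y μ)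
    {J : Set ι} {a : ι → α → ℝ} {s : ℕ} {b : (Fin s → α) → ℝ}
    (hb : Integrable b (Measure.pi fun _ => P)) (hneg : ∫ z, b z ∂(Measure.pi fun _ => P) < 0)
    (hab : ∀ᵐ z ∂(Measure.pi fun _ : Fin s => P), ∀ j ∈ J, ∑ i, a j (z i) ≤ b z) :
    ∀ᶠ x in probFilter μ, ∀ j ∈ J, ∑ i ∈ Finset.range x.1, a j (Y i x.2) < 0 := by
  set Q := Measure.pi fun _ : Fin s => P with hQ
  rcases Set.eq_empty_or_nonempty J with rfl | ⟨j₀, hj₀⟩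
  · simp
  rcases Nat.eq_zero_or_pos s with rfl | hs
  · exfalso
    have h1 : 0 ≤ᵐ[Q] b := by
      filter_upwards [hab] with z hz
      simpa using hz j₀ hj₀
    exact absurd hneg (not_lt.2 (integral_nonneg_of_ae h1))
  have hlaw : ∀ σ : Fin s → ℕ, Function.Injective σ → HasLaw (fun ω i => Y (σ i) ω) Q μ :=
    fun σ hσ => iIndepFun.hasLaw_pi (fun i => hY (σ i)) (hind.precomp hσ)
  have hbound : ∀ᵐ ω ∂μ, ∀ σ : Fin s → ℕ, Function.Injective σ → ∀ j ∈ J,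
      ∑ i, a j (Y (σ i) ω) ≤ b fun i => Y (σ i) ω := by
    refine ae_all_iff.2 fun σ => ?_
    by_cases hσ : Function.Injective σ
    · filter_upwards [(hlaw σ hσ).ae_comp hab] with ω hω _ using hω
    · exact Eventually.of_forall fun ω h => absurd h hσ
  -- For `n ≥ s` the sample size is `n = q n * s + c n`, with a last block of size `c n ≥ s`, so
  -- that the indices in each of its cyclic windows are distinct.
  let q : ℕ → ℕ := fun n => n / s - 1
  let c : ℕ → ℕ := fun n => s + n % s
  have hq : Tendsto q atTop atTop :=
    (tendsto_sub_atTop_nat 1).comp (Nat.tendsto_div_const_atTop hs.ne')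
  let blk : ℕ → Fin s → ℕ := fun k i => k * s + i
  have hblk : ∀ k, Function.Injective (blk k) := fun k i i' h =>
    Fin.ext (Nat.add_left_cancel h)
  let win : ℕ → ℕ → Fin s → ℕ := fun j n i => q n * s + (j + i) % c n
  have hwin : ∀ j n, Function.Injective (win j n) := fun j n =>
    add_mod_injective (Nat.le_add_right _ _) j _
  have hblk_disj : ∀ k k', k ≠ k' → Disjoint (Finset.univ.image (blk k))
      (Finset.univ.image (blk k')) := by
    intro k k' hkk
    rw [Finset.disjoint_left]
    simp only [Finset.mem_image, Finset.mem_univ, true_and, not_exists, blk]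
    rintro _ ⟨i, rfl⟩ i' h
    apply hkk
    have h1 := congrArg (· / s) h
    simpa [Nat.add_mul_div_right, mul_comm k, mul_comm k', Nat.mul_add_div hs,
      Nat.div_eq_of_lt i.2, Nat.div_eq_of_lt i'.2] using h1.symm
  have hblk_ind : Pairwise fun k k' =>
      IndepFun (fun ω i => Y (blk k i) ω) (fun ω i => Y (blk k' i) ω) μ := by
    intro k k' hkk
    have h := hind.indepFun_finset₀ _ _ (hblk_disj k k' hkk) fun i => (hY i).aemeasurable
    exact h.comp
      (φ := fun z (i : Fin s) => z ⟨blk k i, Finset.mem_image_of_mem _ (Finset.mem_univ i)⟩)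
      (ψ := fun z (i : Fin s) => z ⟨blk k' i, Finset.mem_image_of_mem _ (Finset.mem_univ i)⟩)
      (by fun_prop) (by fun_prop)
  have hblocks := tendsto_mean_probFilter (fun k => hlaw _ (hblk k)) hblk_ind hb hq
  have hrest : Tendsto (fun x : ℕ × Ω => ∑ j ∈ Finset.range (2 * s),
      |b fun i => Y (win j x.1 i) x.2| / q x.1) (probFilter μ) (𝓝 0) := by
    have := tendsto_finsetSum (Finset.range (2 * s)) fun j _ =>
      tendsto_div_probFilter (fun n => hlaw _ (hwin j n)) hb.abs hq
    simpa using this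
  set e := ∫ z, b z ∂Q with he
  have hs' : (0 : ℝ) < s := by exact_mod_cast hs
  filter_upwards [eventually_probFilter_of_ae hbound, hblocks.eventually_lt_const
      (show e < e / 2 by linarith), hrest.eventually_lt_const (show 0 < s * (-e / 2) by
        apply mul_pos hs'; linarith), tendsto_fst_probFilter.eventually (eventually_ge_atTop s),
      tendsto_fst_probFilter.eventually (hq.eventually_gt_atTop 0)]
  rintro ⟨n, ω⟩ h1 h2 h3 (h4 : s ≤ n) (h5 : 0 < q n) j hj
  dsimp only at h1 h2 h3 ⊢
  have hq' : (0 : ℝ) < q n := by exact_mod_cast h5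
  have hn : n = q n * s + c n := by
    have e1 := Nat.div_add_mod n s
    have e2 : 1 ≤ n / s := Nat.div_pos h4 hs
    have e3 : n / s = q n + 1 := by simp only [q]; omega
    rw [e3, mul_add, mul_one, mul_comm] at e1
    simp only [c]; omega
  have hc : c n ≤ 2 * s := by
    have := Nat.mod_lt n hs
    simp only [c]; omega
  rw [← Finset.sum_div, div_lt_iff₀ hq'] at h3
  rw [div_lt_iff₀ hq'] at h2
  have hsplit : ∑ i ∈ Finset.range n, a j (Y i ω) =
      ∑ k ∈ Finset.range (q n), ∑ i : Fin s, a j (Y (blk k i) ω) +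
        ∑ i ∈ Finset.range (c n), a j (Y (q n * s + i) ω) := by
    conv_lhs => rw [hn, Finset.sum_range_add]
    congr 1
    generalize q n = N
    induction N with
    | zero => simp
    | succ N ih =>
      rw [Nat.succ_mul, Finset.sum_range_add, ih, Finset.sum_range_succ]
      congr 1
      exact Finset.sum_range fun i => a j (Y (N * s + i) ω)
  have hA : ∑ k ∈ Finset.range (q n), ∑ i : Fin s, a j (Y (blk k i) ω) ≤
      ∑ k ∈ Finset.range (q n), b fun i => Y (blk k i) ω :=
    Finset.sum_le_sum fun k _ => h1 _ (hblk k) j hj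
  have hB : s * ∑ i ∈ Finset.range (c n), a j (Y (q n * s + i) ω) ≤
      ∑ j ∈ Finset.range (2 * s), |b fun i => Y (win j n i) ω| := by
    calc s * ∑ i ∈ Finset.range (c n), a j (Y (q n * s + i) ω)
        = ∑ k ∈ Finset.range (c n), ∑ i : Fin s, a j (Y (win k n i) ω) := by
          rw [Finset.sum_comm]
          have : ∀ i : Fin s, ∑ k ∈ Finset.range (c n), a j (Y (win k n i) ω) =
              ∑ k ∈ Finset.range (c n), a j (Y (q n * s + k) ω) := fun i =>
            sum_range_add_mod (fun k => a j (Y (q n * s + k) ω)) (c n) i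
          simp [this]
      _ ≤ ∑ k ∈ Finset.range (c n), |b fun i => Y (win k n i) ω| :=
          Finset.sum_le_sum fun k _ => (h1 _ (hwin k n) j hj).trans (le_abs_self _)
      _ ≤ _ := Finset.sum_le_sum_of_subset_of_nonneg (Finset.range_mono hc)
          fun _ _ _ => abs_nonneg _
  rw [hsplit]
  have hA' := mul_le_mul_of_nonneg_left hA hs'.le
  have h2' := mul_lt_mul_of_pos_left h2 hs'
  by_contra! hcon
  have hcon' := mul_nonneg hs'.le hcon
  rw [mul_add] at hcon'
  nlinarith

end Wald

/-- Under Wald's condition the expected log-likelihood ratio is nonpositive. -/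
lemma integral_nonpos_of_wald {α ι : Type*} [MeasurableSpace α] {P : Measure α}
    [IsProbabilityMeasure P] {J : Set ι} {a : ι → α → ℝ} {s : ℕ} {b : (Fin s → α) → ℝ}
    (hb : Integrable b (Measure.pi fun _ => P)) (hneg : ∫ z, b z ∂(Measure.pi fun _ => P) < 0)
    (hab : ∀ᵐ z ∂(Measure.pi fun _ : Fin s => P), ∀ j ∈ J, ∑ i, a j (z i) ≤ b z)
    {j : ι} (hj : j ∈ J) (ha : Integrable (a j) P) : ∫ y, a j y ∂P ≤ 0 := by
  have hi : ∀ i : Fin s, Integrable (fun z : Fin s → α => a j (z i)) (Measure.pi fun _ => P) :=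
    fun i => (measurePreserving_eval (fun _ : Fin s => P) i).integrable_comp_of_integrable ha
  have hint : ∀ i : Fin s, ∫ z : Fin s → α, a j (z i) ∂(Measure.pi fun _ => P) =
      ∫ y, a j y ∂P := fun i =>
    (measurePreserving_eval (fun _ : Fin s => P) i).hasLaw.integral_comp ha.aestronglyMeasurable
  have h1 := integral_mono_ae (integrable_finsetSum _ fun i _ => hi i) hb
    (hab.mono fun z hz => hz j hj)
  rw [integral_finsetSum _ fun i _ => hi i] at h1
  simp only [hint, Finset.sum_const, Finset.card_univ, Fintype.card_fin, nsmul_eq_mul] at h1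
  by_contra! hcon
  have : 0 ≤ (s : ℝ) * ∫ y, a j y ∂P := by positivity
  linarith

/-! ### The quadratic form of a positive definite matrix -/

section Bilin

open Matrix

variable {p r : ℕ}

/-- A matrix as a continuous linear map between Euclidean spaces. -/
noncomputable def euclCLM {p q : ℕ} (M : Matrix (Fin q) (Fin p) ℝ) :
    EuclideanSpace ℝ (Fin p) →L[ℝ] EuclideanSpace ℝ (Fin q) :=
  LinearMap.toContinuousLinearMap (Matrix.toEuclideanLin M)

lemma euclCLM_ofLp {p q : ℕ} (M : Matrix (Fin q) (Fin p) ℝ) (v : EuclideanSpace ℝ (Fin p)) :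
    (euclCLM M v).ofLp = M *ᵥ v.ofLp := rfl

/-- The bilinear form `(u, v) ↦ vᵀ H u`. -/
noncomputable def matBilin (H : Matrix (Fin p) (Fin p) ℝ) : Param p →L[ℝ] Param p →L[ℝ] ℝ :=
  (isBoundedBilinearMap_inner (𝕜 := ℝ) (E := Param p)).toContinuousLinearMap ∘L euclCLM H

lemma matBilin_apply (H : Matrix (Fin p) (Fin p) ℝ) (u v : Param p) :
    matBilin H u v = v.ofLp ⬝ᵥ H *ᵥ u.ofLp := by
  change inner ℝ (euclCLM H u) v = _
  rw [EuclideanSpace.inner_eq_star_dotProduct]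
  simp [euclCLM_ofLp]

lemma matBilin_self (H : Matrix (Fin p) (Fin p) ℝ) (v : Param p) :
    matBilin H v v = ∑ i, ∑ j, v i * v j * H i j := by
  rw [matBilin_apply]
  simp only [dotProduct, mulVec, Finset.mul_sum]
  exact Finset.sum_congr rfl fun i _ => Finset.sum_congr rfl fun j _ => by ring

variable {H : Matrix (Fin p) (Fin p) ℝ}

lemma matBilin_symm (hH : H.PosDef) (u v : Param p) : matBilin H u v = matBilin H v u := by
  have hsym : Hᵀ = H := by simpa using hH.isHermitian.eq
  rw [matBilin_apply, matBilin_apply, dotProduct_mulVec, ← mulVec_transpose, hsym,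
    dotProduct_comm]

lemma isCoercive_of_pos {E : Type*} [NormedAddCommGroup E] [NormedSpace ℝ E]
    [FiniteDimensional ℝ E] {B : E →L[ℝ] E →L[ℝ] ℝ} (hB : ∀ v, v ≠ 0 → 0 < B v v) :
    IsCoercive B := by
  rcases subsingleton_or_nontrivial E with hE | hE
  · exact ⟨1, one_pos, fun u => by simp [Subsingleton.elim u 0]⟩
  have hcont : Continuous fun v => B v v := by fun_prop
  obtain ⟨v, hv, hmin⟩ := (isCompact_sphere (0 : E) 1).exists_isMinOn
    (NormedSpace.sphere_nonempty.2 zero_le_one) hcont.continuousOn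
  have hv1 : ‖v‖ = 1 := by simpa using hv
  refine ⟨B v v, hB v (by rintro rfl; simp at hv1), fun u => ?_⟩
  rcases eq_or_ne u 0 with rfl | hu
  · simp
  have hu' : 0 < ‖u‖ := norm_pos_iff.2 hu
  have h1 : B v v ≤ B (‖u‖⁻¹ • u) (‖u‖⁻¹ • u) :=
    hmin (by simp [norm_smul, hu'.ne'])
  simp only [map_smul, _root_.smul_apply, smul_eq_mul] at h1
  rw [← mul_assoc, ← mul_inv, ← div_eq_inv_mul, le_div_iff₀ (by positivity)] at h1
  rwa [mul_assoc]

lemma matBilin_coercive (hH : H.PosDef) : IsCoercive (matBilin H) := by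
  refine isCoercive_of_pos fun v hv => ?_
  rw [matBilin_apply]
  have := hH.dotProduct_mulVec_pos (x := v.ofLp) (by simpa using hv)
  simpa using this

lemma matBilin_inv_single (hH : H.PosDef) (j : Fin p) (v : Param p) :
    matBilin H (euclCLM H⁻¹ (EuclideanSpace.single j 1)) v = v j := by
  have hu := (Matrix.isUnit_iff_isUnit_det _).1 hH.isUnit
  rw [matBilin_apply, euclCLM_ofLp, mulVec_mulVec, Matrix.mul_nonsing_inv _ hu, one_mulVec]
  simp

variable {G : Matrix (Fin p) (Fin r) ℝ}

lemma matBilin_projMat (hH : H.PosDef) (hG : G.rank = r) (u w : Param p) :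
    matBilin H (u - euclCLM (projMat H G) u) (euclCLM (projMat H G) w) = 0 := by
  have h1 : (u - euclCLM (projMat H G) u).ofLp = (1 - projMat H G) *ᵥ u.ofLp := by
    simp [euclCLM_ofLp, sub_mulVec]
  rw [matBilin_symm hH, matBilin_apply, h1, euclCLM_ofLp, dotProduct_comm, dotProduct_mulVec,
    ← mulVec_transpose, mulVec_mulVec, mulVec_mulVec,
    transpose_mul_mul_projMat hH hG, zero_mulVec, zero_dotProduct]

end Bilin

/-! ### Measurability of the composite likelihood -/

section Model

variable {m p K r : ℕ} {F : Family m p} {S : Scheme m K} {θ₀ : Param p}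

lemma measurable_marginal {θ : Param p} (hθ : θ ∈ F.Θ) (A : Finset (Fin m)) :
    Measurable (F.marginal A θ) := by
  have := F.sigmaFinite_ν
  have h : Measurable (Function.uncurry fun (y : Fin m → ℝ) (z : {j : Fin m // j ∉ A} → ℝ) =>
      F.f θ (fun j => if h : j ∈ A then y j else z ⟨j, h⟩)) := by
    refine (F.measurable_f θ hθ).comp (measurable_pi_lambda _ fun j => ?_)
    by_cases h : j ∈ A
    · simp only [h, dite_true]; fun_prop
    · simp only [h, dite_false]; fun_prop
  exact h.stronglyMeasurable.integral_prod_right.measurable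

lemma measurable_cl {θ : Param p} (hθ : θ ∈ F.Θ) : Measurable (cl F S θ) :=
  Finset.measurable_fun_sum _ fun _ _ => ((measurable_marginal hθ _).div
    (measurable_marginal hθ _)).log.const_mul _

lemma isProbabilityMeasure_law {θ : Param p} (hθ : θ ∈ F.Θ) : IsProbabilityMeasure (F.law θ) :=
  ⟨by rw [Family.law, withDensity_apply _ MeasurableSet.univ, Measure.restrict_univ,
    F.lintegral_f θ hθ]⟩

lemma Regular.exists_smoothDom (h : Regular F S θ₀) :
    ∃ ε M, SmoothDom (F.law θ₀) (cl F S) θ₀ ε M ∧ Metric.ball θ₀ ε ⊆ F.Θ := by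
  obtain ⟨ε, hε, M, hM, hae⟩ := h.smooth
  obtain ⟨ε', hε', hsub⟩ := Metric.mem_nhds_iff.1 (mem_interior_iff_mem_nhds.1 h.interior)
  have hb : Metric.ball θ₀ (min ε ε') ⊆ Metric.ball θ₀ ε :=
    Metric.ball_subset_ball (min_le_left _ _)
  have hb' : Metric.ball θ₀ (min ε ε') ⊆ F.Θ :=
    (Metric.ball_subset_ball (min_le_right _ _)).trans hsub
  refine ⟨min ε ε', M, ⟨lt_min hε hε', fun θ hθ => (measurable_cl (hb' hθ)).aemeasurable, hM,
    ?_, ?_⟩, hb'⟩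
  · filter_upwards [hae] with y hy using hy.1.mono hb
  · filter_upwards [hae] with y hy θ hθ using hy.2 θ (hb hθ)

/-! ### The score and the sensitivity matrix -/

lemma score_apply (θ : Param p) (y : Fin m → ℝ) (j : Fin p) :
    score F S θ y j = fderiv ℝ (fun θ' => cl F S θ' y) θ (EuclideanSpace.single j 1) := by
  have h : inner ℝ (score F S θ y) (EuclideanSpace.single j 1) =
      fderiv ℝ (fun θ' => cl F S θ' y) θ (EuclideanSpace.single j 1) :=
    InnerProductSpace.toDual_symm_apply
  rw [← h, EuclideanSpace.inner_single_right]
  simp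

variable {ε : ℝ} {M : (Fin m → ℝ) → ℝ}

lemma sensitivity_apply (hf : SmoothDom (F.law θ₀) (cl F S) θ₀ ε M) (i j : Fin p) :
    sensitivity F S θ₀ i j = -∫ y, fderiv ℝ (fderiv ℝ fun θ => cl F S θ y) θ₀
      (EuclideanSpace.single i 1) (EuclideanSpace.single j 1) ∂(F.law θ₀) := by
  rw [sensitivity, Matrix.of_apply, integral_neg]
  congr 1
  refine integral_congr_ae ?_
  filter_upwards [hf.contDiffOn] with y hy
  have hd := differentiableAt_fderiv_of_contDiffOn hy (Metric.mem_ball_self hf.pos)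
  simp only [score_apply]
  rw [fderiv_clm_apply hd (differentiableAt_const _)]
  simp

lemma Regular.memLp_score (h : Regular F S θ₀) (hf : SmoothDom (F.law θ₀) (cl F S) θ₀ ε M)
    (j : Fin p) : MemLp (fun y => score F S θ₀ y j) 2 (F.law θ₀) := by
  have hm : AEStronglyMeasurable (fun y => score F S θ₀ y j) (F.law θ₀) := by
    simp only [score_apply]
    exact (hf.aemeasurable_fderiv (Metric.mem_ball_self hf.pos) _).aestronglyMeasurable
  refine (memLp_two_iff_integrable_sq hm).2 (h.score_sq.mono' (hm.pow 2) ?_)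
  refine Eventually.of_forall fun y => ?_
  rw [norm_pow]
  gcongr
  exact PiLp.norm_apply_le _ _

/-- The score has mean zero at the true parameter, which maximizes the expected composite
log-likelihood by Wald's condition. -/
lemma Regular.integral_score (h : Regular F S θ₀) (hf : SmoothDom (F.law θ₀) (cl F S) θ₀ ε M)
    (hΘ : Metric.ball θ₀ ε ⊆ F.Θ) (j : Fin p) : ∫ y, score F S θ₀ y j ∂(F.law θ₀) = 0 := by
  have := isProbabilityMeasure_law (hΘ (Metric.mem_ball_self hf.pos))
  set u : (Fin m → ℝ) → ℝ := fun y => score F S θ₀ y j with hu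
  set e : Param p := EuclideanSpace.single j 1 with he
  have hnorm : ‖e‖ = 1 := by simp [he]
  have hui : Integrable u (F.law θ₀) := (h.memLp_score hf j).integrable (by norm_num)
  -- The second-order term and the Taylor remainder at `t • e` contribute at most `M t² / 2` and
  -- `2 M t²`. Division by `t`, from either side of zero, then gives the claim.
  set C := ∫ y, 5 / 2 * M y ∂(F.law θ₀)
  have key : ∀ t : ℝ, t ≠ 0 → |t| < ε → t * ∫ y, u y ∂(F.law θ₀) ≤ C * t ^ 2 := by
    intro t ht htε
    have hte : ‖t • e‖ = |t| := by rw [norm_smul, hnorm, mul_one, Real.norm_eq_abs]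
    have hmem : θ₀ + t • e ∈ F.Θ := hΘ (by simpa [hte] using htε)
    have hne : θ₀ + t • e ≠ θ₀ := by
      simp only [ne_eq, add_eq_left, smul_eq_zero, ht, false_or]
      rintro h0
      simp [h0] at hnorm
    have hexp : ∀ y, cl F S (θ₀ + t • e) y - cl F S θ₀ y = t * u y +
        (1 / 2 * (t ^ 2 * fderiv ℝ (fderiv ℝ fun θ => cl F S θ y) θ₀ e e) +
          taylorRem (fun θ => cl F S θ y) θ₀ (t • e)) := fun y => by
      simp only [taylorRem, hu, score_apply, ← he, map_smul, _root_.smul_apply, smul_eq_mul]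
      ring
    have i1 := hui.const_mul t
    have i2 := ((hf.integrable_fderiv_fderiv e e).const_mul (t ^ 2)).const_mul (1 / 2)
    have i3 := hf.integrable_taylorRem (v := t • e) (by rwa [hte])
    have i23 : Integrable (fun y =>
        1 / 2 * (t ^ 2 * fderiv ℝ (fderiv ℝ fun θ => cl F S θ y) θ₀ e e) +
          taylorRem (fun θ => cl F S θ y) θ₀ (t • e)) (F.law θ₀) := i2.add i3
    have i4 : Integrable (fun y => cl F S (θ₀ + t • e) y - cl F S θ₀ y) (F.law θ₀) := by
      simp only [hexp]
      exact i1.add i23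
    -- Wald's condition, off a neighbourhood of `θ₀` which misses the single point `θ₀ + t • e`.
    obtain ⟨s, b, hb, hneg, hab⟩ := h.wald {θ₀ + t • e}ᶜ
      (isOpen_compl_singleton.mem_nhds (by simpa using hne.symm))
    have h1 := integral_nonpos_of_wald (a := fun θ y => cl F S θ y - cl F S θ₀ y) hb hneg hab
      (j := θ₀ + t • e) ⟨hmem, by simp⟩ i4
    simp only [hexp] at h1
    rw [integral_add i1 i23, integral_const_mul] at h1
    have h2 : -∫ y, (1 / 2 * (t ^ 2 * fderiv ℝ (fderiv ℝ fun θ => cl F S θ y) θ₀ e e) +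
          taylorRem (fun θ => cl F S θ y) θ₀ (t • e)) ∂(F.law θ₀) ≤ C * t ^ 2 := by
      rw [← integral_neg, ← integral_mul_const]
      refine integral_mono_ae i23.neg ((hf.integrable.const_mul _).mul_const _) ?_
      filter_upwards [hf.norm_fderiv_fderiv_le, hf.abs_taylorRem_le] with y h3 h4
      have h5 := (abs_le.1 (h4 (t • e) (by rwa [hte]))).1
      have h6 := (abs_le.1 ((fderiv ℝ (fderiv ℝ fun θ => cl F S θ y) θ₀).le_opNorm₂ e e)).1
      rw [hnorm, mul_one, mul_one] at h6
      rw [hte, sq_abs] at h5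
      have h7 := mul_le_mul_of_nonneg_left (show -fderiv ℝ (fderiv ℝ fun θ => cl F S θ y) θ₀ e e
        ≤ M y by linarith) (sq_nonneg t)
      linarith
    linarith
  have hlim : Tendsto (fun t : ℝ => C * t) (𝓝 0) (𝓝 0) := by
    simpa using (tendsto_id (α := ℝ) (x := 𝓝 0)).const_mul C
  have hsmall : ∀ᶠ t : ℝ in 𝓝 0, |t| < ε :=
    (continuous_abs.tendsto (0 : ℝ)).eventually_lt_const (by simpa using hf.pos)
  refine le_antisymm ?_ ?_
  · refine ge_of_tendsto (hlim.mono_left (nhdsWithin_le_nhds (s := Set.Ioi 0))) ?_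
    filter_upwards [self_mem_nhdsWithin, hsmall.filter_mono nhdsWithin_le_nhds] with t ht htε
    have ht' : 0 < t := ht
    have := key t ht'.ne' htε
    nlinarith
  · refine le_of_tendsto (hlim.mono_left (nhdsWithin_le_nhds (s := Set.Iio 0))) ?_
    filter_upwards [self_mem_nhdsWithin, hsmall.filter_mono nhdsWithin_le_nhds] with t ht htε
    have ht' : t < 0 := ht
    have := key t ht'.ne htε
    nlinarith

end Model

/-! ### The composite likelihood of a sample is locally quadratic -/

section Local

variable {m p K : ℕ} {Ω : Type*}

/-- The centre of the quadratic approximation to the composite log-likelihood of the sample: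
`H⁻¹ u`, with `u` the mean composite score of the first `n` observations. -/
noncomputable def centre (F : Family m p) (S : Scheme m K) (θ₀ : Param p)
    (Y : ℕ → Ω → Fin m → ℝ) (x : ℕ × Ω) : Param p :=
  ∑ j, ((∑ i ∈ Finset.range x.1, score F S θ₀ (Y i x.2) j) / x.1) •
    euclCLM (sensitivity F S θ₀)⁻¹ (EuclideanSpace.single j 1)

/-- The mean composite log-likelihood ratio of `θ₀ + v` and `θ₀` in the first `n` observations. -/
noncomputable def meanLogRatio (F : Family m p) (S : Scheme m K) (θ₀ : Param p)
    (Y : ℕ → Ω → Fin m → ℝ) (x : ℕ × Ω) (v : Param p) : ℝ :=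
  (∑ i ∈ Finset.range x.1, (cl F S (θ₀ + v) (Y i x.2) - cl F S θ₀ (Y i x.2))) / x.1

variable {F : Family m p} {S : Scheme m K} {θ₀ : Param p} {Y : ℕ → Ω → Fin m → ℝ}

/-- The deviation of the mean log-likelihood ratio from its quadratic approximation consists of
the fluctuation of the mean second derivative and the mean of the Taylor remainders. -/
lemma meanLogRatio_sub (hH : (sensitivity F S θ₀).PosDef) (x : ℕ × Ω) (v : Param p) :
    meanLogRatio F S θ₀ Y x v - (matBilin (sensitivity F S θ₀) (centre F S θ₀ Y x) v -
        1 / 2 * matBilin (sensitivity F S θ₀) v v) =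
      1 / 2 * ∑ i, ∑ j, v i * v j * ((∑ k ∈ Finset.range x.1,
        fderiv ℝ (fderiv ℝ fun θ => cl F S θ (Y k x.2)) θ₀ (EuclideanSpace.single i 1)
          (EuclideanSpace.single j 1)) / x.1 + sensitivity F S θ₀ i j) +
      (∑ k ∈ Finset.range x.1, taylorRem (fun θ => cl F S θ (Y k x.2)) θ₀ v) / x.1 := by
  have hv : v = ∑ j, v j • EuclideanSpace.single j (1 : ℝ) := by
    ext i
    simp [Finset.sum_apply, Pi.single_apply]
  have hcoord : ∀ L : Param p →L[ℝ] ℝ, L v = ∑ j, v j * L (EuclideanSpace.single j 1) := by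
    intro L
    conv_lhs => rw [hv, map_sum]
    simp
  have hcoord2 : ∀ D : Param p →L[ℝ] Param p →L[ℝ] ℝ, D v v = ∑ i, ∑ j, v i * v j *
      D (EuclideanSpace.single i 1) (EuclideanSpace.single j 1) := by
    intro D
    have := hcoord (D.flip v)
    rw [ContinuousLinearMap.flip_apply] at this
    rw [this]
    refine Finset.sum_congr rfl fun i _ => ?_
    rw [ContinuousLinearMap.flip_apply, hcoord, Finset.mul_sum]
    exact Finset.sum_congr rfl fun j _ => by ring
  have hc : matBilin (sensitivity F S θ₀) (centre F S θ₀ Y x) v =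
      (∑ k ∈ Finset.range x.1, fderiv ℝ (fun θ => cl F S θ (Y k x.2)) θ₀ v) / x.1 := by
    simp only [centre, map_sum, map_smul, _root_.sum_apply, _root_.smul_apply,
      matBilin_inv_single hH, smul_eq_mul, score_apply, hcoord (fderiv ℝ _ _)]
    rw [Finset.sum_comm, Finset.sum_div]
    refine Finset.sum_congr rfl fun j _ => ?_
    rw [← Finset.mul_sum]
    ring
  have hD : ∑ i, ∑ j, v i * v j * ((∑ k ∈ Finset.range x.1,
        fderiv ℝ (fderiv ℝ fun θ => cl F S θ (Y k x.2)) θ₀ (EuclideanSpace.single i 1)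
          (EuclideanSpace.single j 1)) / x.1) =
      (∑ k ∈ Finset.range x.1, fderiv ℝ (fderiv ℝ fun θ => cl F S θ (Y k x.2)) θ₀ v v) /
        x.1 := by
    simp only [fun k => hcoord2 (fderiv ℝ (fderiv ℝ fun θ => cl F S θ (Y k x.2)) θ₀)]
    symm
    rw [Finset.sum_comm, Finset.sum_div]
    refine Finset.sum_congr rfl fun i _ => ?_
    rw [Finset.sum_comm, Finset.sum_div]
    refine Finset.sum_congr rfl fun j _ => ?_
    rw [← Finset.mul_sum, mul_div_assoc]
  simp only [mul_add, Finset.sum_add_distrib]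
  rw [hD, ← matBilin_self, hc, meanLogRatio]
  simp only [taylorRem, Finset.sum_sub_distrib, ← Finset.mul_sum]
  ring

variable [MeasurableSpace Ω] {μ : Measure Ω} [IsProbabilityMeasure μ]
  (hreg : Regular F S θ₀) (hY : ∀ i, HasLaw (Y i) (F.law θ₀) μ) (hind : iIndepFun Y μ)
include hreg hY hind

lemma Regular.locallyQuadratic : LocallyQuadratic (probFilter μ)
    (matBilin (sensitivity F S θ₀)) (centre F S θ₀ Y) (meanLogRatio F S θ₀ Y) := by
  obtain ⟨ε, M, hf, hΘ⟩ := hreg.exists_smoothDom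
  have hpair : Pairwise fun i j => IndepFun (Y i) (Y j) μ := fun i j hij => hind.indepFun hij
  intro η hη
  obtain ⟨ρ, hρ, R, hR, hRη, hrem⟩ := hf.exists_taylorRem_le (η := η / 4) (by positivity)
  have hRmean := tendsto_mean_probFilter hY hpair hR tendsto_id
  have hDmean : Tendsto (fun x : ℕ × Ω => ∑ i, ∑ j, |(∑ k ∈ Finset.range x.1,
        fderiv ℝ (fderiv ℝ fun θ => cl F S θ (Y k x.2)) θ₀ (EuclideanSpace.single i 1)
          (EuclideanSpace.single j 1)) / x.1 + sensitivity F S θ₀ i j|) (probFilter μ) (𝓝 0) := by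
    have h0 : (0 : ℝ) = ∑ _i : Fin p, ∑ _j : Fin p, |(0 : ℝ)| := by simp
    rw [h0]
    refine tendsto_finsetSum _ fun i _ => tendsto_finsetSum _ fun j _ => Tendsto.abs ?_
    have h1 := (tendsto_mean_probFilter hY hpair (hf.integrable_fderiv_fderiv
      (EuclideanSpace.single i 1) (EuclideanSpace.single j 1)) tendsto_id).add_const
        (sensitivity F S θ₀ i j)
    rwa [sensitivity_apply hf, add_neg_cancel, ← sensitivity_apply hf] at h1
  have hae : ∀ᵐ ω ∂μ, ∀ k, ∀ v, ‖v‖ < ρ →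
      |taylorRem (fun θ => cl F S θ (Y k ω)) θ₀ v| ≤ R (Y k ω) * ‖v‖ ^ 2 :=
    ae_all_iff.2 fun k => (hY k).ae_comp hrem
  refine ⟨ρ, hρ, ?_⟩
  filter_upwards [eventually_probFilter_of_ae hae, hRmean.eventually_lt_const
    (show _ < η / 2 by linarith), hDmean.eventually_lt_const (show 0 < η / 2 by positivity)]
  rintro ⟨n, ω⟩ h1 h2 h3 v hv
  dsimp only [id] at h1 h2 h3
  rw [meanLogRatio_sub hreg.posDef]
  dsimp only
  have hquad : |∑ i, ∑ j, v i * v j * ((∑ k ∈ Finset.range n,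
        fderiv ℝ (fderiv ℝ fun θ => cl F S θ (Y k ω)) θ₀ (EuclideanSpace.single i 1)
          (EuclideanSpace.single j 1)) / n + sensitivity F S θ₀ i j)| ≤ η / 2 * ‖v‖ ^ 2 := by
    refine le_trans ?_ (mul_le_mul_of_nonneg_right h3.le (sq_nonneg ‖v‖))
    rw [Finset.sum_mul]
    refine (Finset.abs_sum_le_sum_abs _ _).trans (Finset.sum_le_sum fun i _ => ?_)
    rw [Finset.sum_mul]
    refine (Finset.abs_sum_le_sum_abs _ _).trans (Finset.sum_le_sum fun j _ => ?_)
    rw [abs_mul, abs_mul, mul_comm, pow_two]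
    have h4 := PiLp.norm_apply_le v i
    have h5 := PiLp.norm_apply_le v j
    gcongr
    · exact h4
    · exact h5
  have htay : |(∑ k ∈ Finset.range n, taylorRem (fun θ => cl F S θ (Y k ω)) θ₀ v) / n| ≤
      η / 2 * ‖v‖ ^ 2 := by
    refine le_trans ?_ (mul_le_mul_of_nonneg_right h2.le (sq_nonneg ‖v‖))
    rw [abs_div, Nat.abs_cast, div_mul_eq_mul_div, Finset.sum_mul]
    gcongr
    exact (Finset.abs_sum_le_sum_abs _ _).trans (Finset.sum_le_sum fun k _ => h1 k v hv)
  refine (abs_add_le _ _).trans ?_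
  rw [abs_mul, abs_of_pos (by norm_num : (0 : ℝ) < 1 / 2)]
  have : 0 ≤ η * ‖v‖ ^ 2 := by positivity
  linarith

/-- The law of large numbers for the centred score. -/
lemma Regular.tendsto_centre : Tendsto (centre F S θ₀ Y) (probFilter μ) (𝓝 0) := by
  obtain ⟨ε, M, hf, hΘ⟩ := hreg.exists_smoothDom
  have := isProbabilityMeasure_law (hΘ (Metric.mem_ball_self hf.pos))
  have hpair : Pairwise fun i j => IndepFun (Y i) (Y j) μ := fun i j hij => hind.indepFun hij
  have h := tendsto_finsetSum (Finset.univ : Finset (Fin p)) fun j _ =>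
    (tendsto_mean_probFilter hY hpair ((hreg.memLp_score hf j).integrable (by norm_num))
      tendsto_id).smul_const (euclCLM (sensitivity F S θ₀)⁻¹ (EuclideanSpace.single j 1))
  simp only [hreg.integral_score hf hΘ, zero_smul, Finset.sum_const_zero] at h
  exact h

lemma Regular.boundedInProb_centre :
    BoundedInProb μ fun n ω => √(n : ℝ) • centre F S θ₀ Y (n, ω) := by
  obtain ⟨ε, M, hf, hΘ⟩ := hreg.exists_smoothDom
  have := isProbabilityMeasure_law (hΘ (Metric.mem_ball_self hf.pos))
  have hpair : Pairwise fun i j => IndepFun (Y i) (Y j) μ := fun i j hij => hind.indepFun hij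
  simp only [centre, Finset.smul_sum]
  refine BoundedInProb.sum _ fun j _ => ?_
  refine (boundedInProb_sum_div_sqrt hY hpair (hreg.memLp_score hf j)
    (hreg.integral_score hf hΘ j)).of_norm_le
    (C := ‖euclCLM (sensitivity F S θ₀)⁻¹ (EuclideanSpace.single j 1)‖) fun n ω => ?_
  rw [smul_smul, norm_smul, mul_comm, mul_div_left_comm, Real.sqrt_div_self, div_eq_mul_inv]

/-! ### Asymptotics of maximum composite likelihood estimators -/

omit [IsProbabilityMeasure μ] hreg hY hind in
lemma IsArgmaxEstimator.eventually {C : Set (Param p)} {T : ℕ → Ω → Param p}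
    (hT : IsArgmaxEstimator μ F S C Y T) :
    ∀ᶠ x in probFilter μ, IsArgmax F S C x.1 (fun i => Y i x.2) (T x.1 x.2) :=
  eventually_probFilter.2 hT

/-- Consistency: off a neighbourhood of `θ₀` the criterion is, with probability tending to one,
smaller than at `θ₀`. -/
lemma IsArgmaxEstimator.tendsto {C : Set (Param p)} (hC : C ⊆ F.Θ) (h0 : θ₀ ∈ C)
    {T : ℕ → Ω → Param p} (hT : IsArgmaxEstimator μ F S C Y T) :
    Tendsto (fun x : ℕ × Ω => T x.1 x.2 - θ₀) (probFilter μ) (𝓝 0) := by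
  rw [← sub_self θ₀]
  refine Tendsto.sub_const (fun U hU => mem_map.2 ?_) _
  obtain ⟨s, b, hb, hneg, hab⟩ := hreg.wald U hU
  have h := eventually_sum_neg_of_wald (a := fun θ y => cl F S θ y - cl F S θ₀ y) hY hind hb hneg
    hab
  filter_upwards [h, hT.eventually] with x h1 h2
  by_contra hx
  have h3 := h1 _ ⟨hC h2.1, hx⟩
  have h4 := h2.2 θ₀ h0
  rw [Finset.sum_sub_distrib] at h3
  linarith

/-- A consistent maximizer over `C` is, up to `o_P(n^{-1/2})`, the projection of the centre onto the
tangent space of `C` at `θ₀`. -/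
lemma IsArgmaxEstimator.sub_proj_isLittleO {C : Set (Param p)} (hC : C ⊆ F.Θ) (h0 : θ₀ ∈ C)
    {T : ℕ → Ω → Param p} (hT : IsArgmaxEstimator μ F S C Y T) {P : Param p →L[ℝ] Param p}
    (horth : ∀ u w, matBilin (sensitivity F S θ₀) (u - P u) (P w) = 0) {φ : Param p → Param p}
    (hφ : ∀ᶠ v in 𝓝 0, θ₀ + φ v ∈ C) (hφP : (fun v => φ v - P v) =o[𝓝 0] fun v => v)
    (hCP : (fun v => v - P v) =o[𝓝[{v | θ₀ + v ∈ C}] 0] fun v => v) :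
    (fun x : ℕ × Ω => T x.1 x.2 - θ₀ - P (centre F S θ₀ Y x)) =o[probFilter μ]
      centre F S θ₀ Y := by
  refine (hreg.locallyQuadratic hY hind).argmax_sub_proj_isLittleO (matBilin_coercive hreg.posDef)
    (matBilin_symm hreg.posDef) horth (C := {v | θ₀ + v ∈ C}) hφ hφP hCP (by simpa using h0)
    (hreg.tendsto_centre hY hind) (hT.tendsto hreg hY hind hC h0) ?_ ?_
  · filter_upwards [hT.eventually] with x hx
    simpa using hx.1
  · filter_upwards [hT.eventually] with x hx v hv
    simp only [meanLogRatio, add_sub_cancel, Finset.sum_sub_distrib]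
    exact div_le_div_of_nonneg_right (sub_le_sub_right (hx.2 _ hv) _) (Nat.cast_nonneg _)

end Local

/-! ### The constraint -/

section Constraint

open Matrix

variable {p r : ℕ} {g : Param p → EuclideanSpace ℝ (Fin r)} {θ₀ : Param p}

lemma fderiv_eq_jac (g : Param p → EuclideanSpace ℝ (Fin r)) (θ₀ v : Param p) :
    fderiv ℝ g θ₀ v = euclCLM (jac g θ₀)ᵀ v := by
  have hv : v = ∑ j, v j • EuclideanSpace.single j (1 : ℝ) := by
    ext i
    simp [Finset.sum_apply, Pi.single_apply]
  ext j
  rw [euclCLM_ofLp]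
  conv_lhs => rw [hv, map_sum]
  simp [mulVec, dotProduct, jac, mul_comm]

lemma fderiv_surjective (hrank : (jac g θ₀).rank = r) :
    Function.Surjective (fderiv ℝ g θ₀) := by
  have h : LinearMap.range (jac g θ₀)ᵀ.mulVecLin = ⊤ := by
    refine Submodule.eq_top_of_finrank_eq ?_
    have : (jac g θ₀)ᵀ.rank = r := by rw [rank_transpose, hrank]
    simpa [Matrix.rank] using this
  intro w
  obtain ⟨v, hv⟩ := LinearMap.range_eq_top.1 h w.ofLp
  refine ⟨WithLp.toLp 2 v, ?_⟩
  rw [fderiv_eq_jac]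
  ext j
  exact congrFun hv j

variable {H : Matrix (Fin p) (Fin p) ℝ}

lemma fderiv_projMat (hH : H.PosDef) (hrank : (jac g θ₀).rank = r) (v : Param p) :
    fderiv ℝ g θ₀ (euclCLM (projMat H (jac g θ₀)) v) = 0 := by
  rw [fderiv_eq_jac]
  ext j
  rw [euclCLM_ofLp, euclCLM_ofLp, mulVec_mulVec, transpose_mul_projMat hH hrank]
  simp

lemma sub_projMat_apply (H : Matrix (Fin p) (Fin p) ℝ) (v : Param p) :
    v - euclCLM (projMat H (jac g θ₀)) v =
      euclCLM (H⁻¹ * jac g θ₀ * ((jac g θ₀)ᵀ * H⁻¹ * jac g θ₀)⁻¹) (fderiv ℝ g θ₀ v) := by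
  rw [fderiv_eq_jac]
  ext j
  rw [euclCLM_ofLp, euclCLM_ofLp, mulVec_mulVec, WithLp.ofLp_sub, euclCLM_ofLp, projMat,
    add_mulVec, one_mulVec, Matrix.neg_mul, neg_mulVec]
  simp

/-- Near `θ₀` the constraint set `{g = 0}` is tangent to the kernel of `Gᵀ`. -/
lemma sub_projMat_isLittleO (hg : DifferentiableAt ℝ g θ₀) (hg₀ : g θ₀ = 0) {C : Set (Param p)}
    (hC : ∀ θ ∈ C, g θ = 0) :
    (fun v => v - euclCLM (projMat H (jac g θ₀)) v) =o[𝓝[{v | θ₀ + v ∈ C}] 0] fun v => v := by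
  simp only [sub_projMat_apply]
  refine (ContinuousLinearMap.isBigO_comp _ _ _).trans_isLittleO ?_
  have h := (hasFDerivAt_iff_isLittleO_nhds_zero.1 hg.hasFDerivAt).mono
    (nhdsWithin_le_nhds (s := {v | θ₀ + v ∈ C}))
  refine h.neg_left.congr' ?_ EventuallyEq.rfl
  filter_upwards [self_mem_nhdsWithin] with v hv
  simp [hg₀, hC _ hv]

end Constraint

end CompLik

open CompLik Asymptotics in
theorem mainTheorem2 {m p K r : ℕ} (hr : r < p)
    (F : CompLik.Family m p) (S : CompLik.Scheme m K)
    (g : CompLik.Param p → EuclideanSpace ℝ (Fin r)) (θ₀ : CompLik.Param p)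
    (hreg : CompLik.Regular F S θ₀)
    (hg : ContDiffAt ℝ 1 g θ₀) (hg₀ : g θ₀ = 0) (hrank : (CompLik.jac g θ₀).rank = r)
    {Ω : Type*} [MeasurableSpace Ω] (μ : Measure Ω) [IsProbabilityMeasure μ]
    (Y : ℕ → Ω → Fin m → ℝ) (hlaw : ∀ i, HasLaw (Y i) (F.law θ₀) μ) (hindep : iIndepFun Y μ)
    (θhat θtil : ℕ → Ω → CompLik.Param p)
    (hhat : CompLik.IsArgmaxEstimator μ F S F.Θ Y θhat)
    (htil : CompLik.IsArgmaxEstimator μ F S {θ | θ ∈ F.Θ ∧ g θ = 0} Y θtil) :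
    TendstoInMeasure μ
      (fun (n : ℕ) ω =>
        Real.sqrt n • (θtil n ω - θ₀) -
          Matrix.toEuclideanLin (1 + CompLik.Qmat F S g θ₀ * (CompLik.jac g θ₀).transpose)
            (Real.sqrt n • (θhat n ω - θ₀)))
      atTop (fun _ => 0) := by
  have h0 : θ₀ ∈ F.Θ := interior_subset hreg.interior
  set P := euclCLM (projMat (sensitivity F S θ₀) (jac g θ₀)) with hP
  have hhat' : (fun x : ℕ × Ω => θhat x.1 x.2 - θ₀ - centre F S θ₀ Y x) =o[probFilter μ]
      centre F S θ₀ Y := by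
    refine hhat.sub_proj_isLittleO hreg hlaw hindep subset_rfl h0
      (P := ContinuousLinearMap.id ℝ _) (φ := fun v => v) (by simp) ?_ (by simp) (by simp)
    have h1 : Tendsto (fun v => θ₀ + v) (𝓝 0) (𝓝 θ₀) := by
      simpa using (continuous_const.add continuous_id).tendsto (0 : Param p) (f := fun v => θ₀ + v)
    exact h1.eventually (mem_interior_iff_mem_nhds.1 hreg.interior)
  have htil' : (fun x : ℕ × Ω => θtil x.1 x.2 - θ₀ - P (centre F S θ₀ Y x)) =o[probFilter μ]
      centre F S θ₀ Y := by
    obtain ⟨φ, hφ, hφ0, hφP⟩ := exists_tangent_map (hg.hasStrictFDerivAt one_ne_zero)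
      (fderiv_surjective hrank) (P := P) (fderiv_projMat hreg.posDef hrank)
    refine htil.sub_proj_isLittleO (C := {θ | θ ∈ F.Θ ∧ g θ = 0}) hreg hlaw hindep
      (fun θ hθ => hθ.1) ⟨h0, hg₀⟩
      (matBilin_projMat hreg.posDef hrank) (φ := φ) ?_ hφP
      (sub_projMat_isLittleO (hg.differentiableAt one_ne_zero) hg₀ fun θ hθ => hθ.2)
    have h1 : Tendsto (fun v => θ₀ + φ v) (𝓝 0) (𝓝 θ₀) := by
      simpa using hφ0.const_add θ₀
    filter_upwards [hφ, h1.eventually (mem_interior_iff_mem_nhds.1 hreg.interior)] with v h2 h3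
    exact ⟨h3, h2.trans hg₀⟩
  have hdiff : (fun x : ℕ × Ω => θtil x.1 x.2 - θ₀ - P (θhat x.1 x.2 - θ₀)) =o[probFilter μ]
      centre F S θ₀ Y := by
    refine (htil'.sub ((P.isBigO_comp _ _).trans_isLittleO hhat')).congr_left fun x => ?_
    simp only [map_sub]
    abel
  rw [tendstoInMeasure_iff_tendsto_probFilter]
  refine (hreg.boundedInProb_centre hlaw hindep).tendsto_zero_of_isLittleO ?_
  refine ((isBigO_refl (fun x : ℕ × Ω => √(x.1 : ℝ)) _).smul_isLittleO hdiff).congr_left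
    fun x => ?_
  rw [smul_sub, ← map_smul]
  rfl
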